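/- **Setting.** Let $d\ge 1$, let $\Omega\subseteq\mathbb R^d$ be an open set (for instance a Lipschitz domain), $T>0$, $I=(0,T)$, $\alpha>0$. Let $a_{ij}\in L^\infty(I\times\Omega)$, $1\le i,j\le d$, satisfy $a_{ij}=a_{ji}$ and $\sum_{i,j}a_{ij}(t,x)\xi_i\xi_j\ge\alpha|\xi|^2$ for all $\xi\in\mathbb R^d$ and a.e. $(t,x)\in I\times\Omega$; let $a_{ij}(\cdot,x)$ be continuous on $[0,T]$ for a.e. $x\in\Omega$, and for all $t_1,t_2\in[0,T]$ let $|a_{ij}(t_1,x)-a_{ij}(t_2,x)|\le\omega(|t_1-t_2|)$ for a.e. $x\in\Omega$, where $\omega:[0,T]\to[0,\infty)$ is nondecreasing, $\omega(t)/t^{3/2}$ is nonincreasing on $(0,T]$, and $\int_0^T\omega(t)t^{-3/2}\,dt<\infty$. Let $A(t):H^1_0(\Omega)\to H^{-1}(\Omega)$ be defined by $\langle A(t)u,v\rangle=\int_\Omega\sum_{i,j}a_{ij}(t,x)\,\partial_iu(x)\,\partial_jv(x)\,dx$. For a mesh $0=t_0<t_1<\dots<t_M=T$ put $I_m=(t_{m-1},t_m]$,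 $k_m=t_m-t_{m-1}$, $k=\max_mk_m$, $k_{\min}=\min_mk_m$. Given constants $c,\beta,\kappa>0$, call the mesh admissible if $k_{\min}\ge ck^\beta$, $\kappa^{-1}\le k_m/k_{m+1}\le\kappa$ for $1\le m\le M-1$, and $k\le T/4$. Let $X_k^0$ be the space of functions $g_k:(0,T]\to H^1_0(\Omega)$ that are constant on each $I_m$, with value $g_{k,m}$ there. For $\mu>0$ define $$A_{k,m}=\frac1{k_m}\int_{I_m}A(t)\,dt,\qquad \widetilde A_{k,m}=(1+k_m\mu)A_{k,m}+\mu\,\mathrm{Id},\qquad \widetilde R_{m,l}=\prod_{j=1}^{m-l+1}(\mathrm{Id}+k_{m+1-j}\widetilde A_{k,m})^{-1},$$ $$(\widetilde Qg_k)_m=\sum_{l=1}^{m-1}k_l\,\widetilde A_{k,m}\widetilde R_{m,l}(\widetilde A_{k,m}-\widetilde A_{k,l})\widetilde A_{k,l}^{-1}g_{k,l},\qquad 1\le m\le M,$$ where $\mathrm{Id}$ denotes the embedding $H^1_0(\Omega)\hookrightarrow L^2(\Omega)\hookrightarrow H^{-1}(\Omega)$. **Proposition.** For given $\Omega,T,\alpha,a_{ij},\omega,c,\beta,\kappa$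 as above there is $\mu_0>0$ such that for every $\mu\ge\mu_0$ there is $\delta_0>0$ with the following property. For every admissible mesh with $k-k_{\min}\le\delta_0$, all operators above are well defined ($\widetilde A_{k,m}$ and $\mathrm{Id}+k_j\widetilde A_{k,m}$ are invertible from $H^1_0(\Omega)$ to $H^{-1}(\Omega)$), $\widetilde Q$ is a linear operator $X_k^0\to X_k^0$, and for all $g_k\in X_k^0$ $$\|(\widetilde Qg_k)_m\|_{L^2(\Omega)}\le\frac34\max_{1\le l\le m}\|g_{k,l}\|_{L^2(\Omega)},\qquad m=1,\dots,M,$$ $$\sum_{m=1}^Mk_m\|(\widetilde Qg_k)_m\|_{L^2(\Omega)}\le\frac34\sum_{l=1}^Mk_l\|g_{k,l}\|_{L^2(\Omega)}.$$ -/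

import Mathlib

open MeasureTheory Set

namespace ParabolicDG

noncomputable section

/-- The Euclidean space `ℝ^d`. -/
abbrev E (d : ℕ) := EuclideanSpace ℝ (Fin d)

/-- The real Hilbert space `L²(Ω)`. -/
abbrev L2 {d : ℕ} (Ω : Set (E d)) := Lp ℝ 2 (volume.restrict Ω)

/-- The ambient Hilbert space `L²(Ω) × L²(Ω)^d` of a function (component `none`) together with
its first order partial derivatives (components `some i`). Its norm restricts to the usual
norm of `H¹(Ω)`: `‖w‖² = ‖u‖² + ∑ i, ‖∂ᵢ u‖²`. -/
abbrev Jet {d : ℕ} (Ω : Set (E d)) := PiLp 2 (fun _ : Option (Fin d) => L2 Ω)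

/-- The elements `(φ, ∂₁ φ, …, ∂_d φ)` with a test function `φ ∈ C_c^∞(Ω)`. -/
def testJets {d : ℕ} (Ω : Set (E d)) : Set (Jet Ω) :=
  {w | ∃ φ : E d → ℝ, ContDiff ℝ ((⊤ : ℕ∞) : WithTop ℕ∞) φ ∧ HasCompactSupport φ ∧ tsupport φ ⊆ Ω ∧
    (w none : E d → ℝ) =ᵐ[volume.restrict Ω] φ ∧
    ∀ i : Fin d, (w (some i) : E d → ℝ) =ᵐ[volume.restrict Ω]
      fun x => fderiv ℝ φ x (EuclideanSpace.single i 1)}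

/-- The closure of `C_c^∞(Ω)` in the `H¹` norm, a function being recorded together with its
weak gradient. (The set `testJets Ω` is already a linear subspace.) -/
def H10Submodule {d : ℕ} (Ω : Set (E d)) : Submodule ℝ (Jet Ω) :=
  (Submodule.span ℝ (testJets Ω)).topologicalClosure

/-- The Hilbert space `H¹₀(Ω)`, with the `H¹` norm. -/
def H10 {d : ℕ} (Ω : Set (E d)) : Type := ↥(H10Submodule Ω)

instance {d : ℕ} (Ω : Set (E d)) : NormedAddCommGroup (H10 Ω) :=
  inferInstanceAs (NormedAddCommGroup ↥(H10Submodule Ω))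

instance {d : ℕ} (Ω : Set (E d)) : InnerProductSpace ℝ (H10 Ω) :=
  inferInstanceAs (InnerProductSpace ℝ ↥(H10Submodule Ω))

instance {d : ℕ} (Ω : Set (E d)) : CompleteSpace (H10 Ω) :=
  inferInstanceAs (CompleteSpace ↥(Submodule.span ℝ (testJets Ω)).topologicalClosure)

/-- The inclusion of `H¹₀(Ω)` into `L²(Ω) × L²(Ω)^d`, `u ↦ (u, ∂₁ u, …, ∂_d u)`. -/
def toJet {d : ℕ} (Ω : Set (E d)) : H10 Ω →L[ℝ] Jet Ω := (H10Submodule Ω).subtypeL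

/-- `H⁻¹(Ω)`: the topological dual of `H¹₀(Ω)`. -/
abbrev Hm1 {d : ℕ} (Ω : Set (E d)) := StrongDual ℝ (H10 Ω)

/-- The inclusion `H¹₀(Ω) → L²(Ω)`. -/
def toL2 {d : ℕ} (Ω : Set (E d)) : H10 Ω →L[ℝ] L2 Ω :=
  (PiLp.proj 2 (fun _ : Option (Fin d) => L2 Ω) none).comp (toJet Ω)

/-- The weak partial derivative `∂ᵢ : H¹₀(Ω) → L²(Ω)`. -/
def partialDeriv {d : ℕ} (Ω : Set (E d)) (i : Fin d) : H10 Ω →L[ℝ] L2 Ω :=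
  (PiLp.proj 2 (fun _ : Option (Fin d) => L2 Ω) (some i)).comp (toJet Ω)

/-- The canonical embedding `Id : H¹₀(Ω) → L²(Ω) → H⁻¹(Ω)`, `⟨u, v⟩ = (u, v)_{L²(Ω)}`. -/
def embed {d : ℕ} (Ω : Set (E d)) : H10 Ω →L[ℝ] Hm1 Ω :=
  ((innerSL ℝ).comp (toL2 Ω)).flip.comp (toL2 Ω)

theorem embed_apply {d : ℕ} (Ω : Set (E d)) (u v : H10 Ω) :
    embed Ω u v = ∫ x in Ω, toL2 Ω u x * toL2 Ω v x := by
  simp [embed, L2.inner_def]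

/-- The bilinear form `a(t; u, v) = ∫_Ω ∑ᵢⱼ aᵢⱼ(t, x) ∂ᵢ u(x) ∂ⱼ v(x) dx`. -/
def aForm {d : ℕ} (Ω : Set (E d)) (a : Fin d → Fin d → ℝ → E d → ℝ) (t : ℝ)
    (u v : H10 Ω) : ℝ :=
  ∫ x in Ω, ∑ i, ∑ j, a i j t x * partialDeriv Ω i u x * partialDeriv Ω j v x

open Classical in
/-- The bounded operator `B : H¹₀(Ω) → H⁻¹(Ω)` with `⟨B u, v⟩ = b(u, v)` for all `u, v`
(which is unique); the value is `0` when there is none. -/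
def opOfForm {d : ℕ} {Ω : Set (E d)} (b : H10 Ω → H10 Ω → ℝ) : H10 Ω →L[ℝ] Hm1 Ω :=
  if h : ∃ B : H10 Ω →L[ℝ] Hm1 Ω, ∀ u v, B u v = b u v then h.choose else 0

/-- The operator `A(t) : H¹₀(Ω) → H⁻¹(Ω)`, `⟨A(t) u, v⟩ = a(t; u, v)`. -/
def opA {d : ℕ} (Ω : Set (E d)) (a : Fin d → Fin d → ℝ → E d → ℝ) (t : ℝ) :
    H10 Ω →L[ℝ] Hm1 Ω :=
  opOfForm (aForm Ω a t)

/-- The assumptions on the coefficients `aᵢⱼ` and on their modulus of continuity `om`. -/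
structure AdmissibleCoeff {d : ℕ} (Ω : Set (E d)) (T α : ℝ) (om : ℝ → ℝ)
    (a : Fin d → Fin d → ℝ → E d → ℝ) : Prop where
  /-- `aᵢⱼ ∈ L^∞(I × Ω)`, `I = (0, T)` -/
  bounded : ∀ i j, MemLp (fun p : ℝ × E d => a i j p.1 p.2) ⊤ (volume.restrict (Ioo 0 T ×ˢ Ω))
  symmetric : ∀ i j, ∀ᵐ p : ℝ × E d ∂(volume.restrict (Ioo 0 T ×ˢ Ω)),
    a i j p.1 p.2 = a j i p.1 p.2
  elliptic : ∀ᵐ p : ℝ × E d ∂(volume.restrict (Ioo 0 T ×ˢ Ω)), ∀ ξ : E d,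
    α * ‖ξ‖ ^ 2 ≤ ∑ i, ∑ j, a i j p.1 p.2 * ξ i * ξ j
  continuous_time : ∀ i j, ∀ᵐ x ∂(volume.restrict Ω),
    ContinuousOn (fun t => a i j t x) (Icc 0 T)
  modulus : ∀ i j, ∀ t₁ ∈ Icc 0 T, ∀ t₂ ∈ Icc 0 T, ∀ᵐ x ∂(volume.restrict Ω),
    |a i j t₁ x - a i j t₂ x| ≤ om |t₁ - t₂|
  omega_nonneg : ∀ t ∈ Icc 0 T, 0 ≤ om t
  omega_mono : MonotoneOn om (Icc 0 T)
  omega_anti : AntitoneOn (fun t => om t / t ^ (3 / 2 : ℝ)) (Ioc 0 T)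
  omega_int : IntegrableOn (fun t => om t / t ^ (3 / 2 : ℝ)) (Ioc 0 T)

/-- A partition `0 = t₀ < t₁ < ⋯ < t_M = T` of `(0, T]` into `I_m = (t_{m-1}, t_m]`,
`m = 1, …, M`. Only the values `t m` with `m ≤ M` matter. -/
structure TimeMesh (T : ℝ) where
  M : ℕ
  t : ℕ → ℝ
  M_pos : 1 ≤ M
  t_zero : t 0 = 0
  t_last : t M = T
  t_lt : ∀ m < M, t m < t (m + 1)

namespace TimeMesh

variable {T : ℝ} (P : TimeMesh T)

/-- The step `k_m = t_m - t_{m-1}`, `1 ≤ m ≤ M`. -/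
def step (m : ℕ) : ℝ := P.t m - P.t (m - 1)

/-- The interval `I_m = (t_{m-1}, t_m]`, `1 ≤ m ≤ M`. -/
def interval (m : ℕ) : Set ℝ := Ioc (P.t (m - 1)) (P.t m)

/-- The maximal step `k`. -/
def kmax : ℝ := (Finset.Icc 1 P.M).sup' (Finset.nonempty_Icc.2 P.M_pos) P.step

/-- The minimal step `k_min`. -/
def kmin : ℝ := (Finset.Icc 1 P.M).inf' (Finset.nonempty_Icc.2 P.M_pos) P.step

/-- The conditions imposed on the time mesh, with the constants `c`, `β`, `κ`. -/
structure Admissible (c β κ : ℝ) : Prop where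
  min_step : c * P.kmax ^ β ≤ P.kmin
  ratio : ∀ m, 1 ≤ m → m + 1 ≤ P.M →
    κ⁻¹ ≤ P.step m / P.step (m + 1) ∧ P.step m / P.step (m + 1) ≤ κ
  max_step : P.kmax ≤ T / 4

/-- The space `X_k^0` of functions `(0, T] → H¹₀(Ω)` that are constant on each `I_m`
(as functions on `ℝ` they are extended by zero). -/
def X0 {d : ℕ} (Ω : Set (E d)) : Submodule ℝ (ℝ → H10 Ω) where
  carrier := {u | (∀ m ∈ Finset.Icc 1 P.M, ∃ w : H10 Ω, ∀ s ∈ P.interval m, u s = w) ∧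
    ∀ s ∉ Ioc 0 T, u s = 0}
  zero_mem' := ⟨fun _ _ => ⟨0, fun _ _ => rfl⟩, fun _ _ => rfl⟩
  add_mem' := by
    rintro u v ⟨hu, hu'⟩ ⟨hv, hv'⟩
    refine ⟨fun m hm => ?_, fun s hs => by simp [hu' s hs, hv' s hs]⟩
    obtain ⟨w, hw⟩ := hu m hm
    obtain ⟨z, hz⟩ := hv m hm
    exact ⟨w + z, fun s hs => by simp [hw s hs, hz s hs]⟩
  smul_mem' := by
    rintro r u ⟨hu, hu'⟩
    refine ⟨fun m hm => ?_, fun s hs => by simp [hu' s hs]⟩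
    obtain ⟨w, hw⟩ := hu m hm
    exact ⟨r • w, fun s hs => by simp [hw s hs]⟩

/-- The value `g_{k,m}` of `g ∈ X_k^0` on `I_m` (note `t_m ∈ I_m`). -/
def val {d : ℕ} {Ω : Set (E d)} (g : P.X0 Ω) (m : ℕ) : H10 Ω := g.1 (P.t m)

end TimeMesh

section Operators

variable {d : ℕ} (Ω : Set (E d)) (a : Fin d → Fin d → ℝ → E d → ℝ) {T : ℝ} (P : TimeMesh T)
  (μ : ℝ)

/-- The average `A_{k,m} = k_m⁻¹ ∫_{I_m} A(t) dt` as an operator `H¹₀(Ω) → H⁻¹(Ω)`, the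
integral of operators being taken in the weak sense:
`⟨A_{k,m} u, v⟩ = k_m⁻¹ ∫_{I_m} ⟨A(t) u, v⟩ dt` for all `u, v ∈ H¹₀(Ω)`. -/
def opAk (m : ℕ) : H10 Ω →L[ℝ] Hm1 Ω :=
  opOfForm fun u v => (P.step m)⁻¹ * ∫ t in P.interval m, opA Ω a t u v

/-- The transformed operator `Ã_{k,m} = (1 + k_m μ) A_{k,m} + μ Id`. -/
def opAt (m : ℕ) : H10 Ω →L[ℝ] Hm1 Ω :=
  (1 + P.step m * μ) • opAk Ω a P m + μ • embed Ω

/-- `r(k_j Ã_{k,m}) = (Id + k_j Ã_{k,m})⁻¹ : H⁻¹(Ω) → H¹₀(Ω)`, where `r(z) = 1 / (1 + z)`. -/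
def resolventStep (m j : ℕ) : Hm1 Ω →L[ℝ] H10 Ω :=
  (embed Ω + P.step j • opAt Ω a P μ m).inverse

/-- The product `r(k_m Ã_{k,m}) r(k_{m-1} Ã_{k,m}) ⋯ r(k_{m-n} Ã_{k,m})` of `n + 1` factors. -/
def resolventProd (m : ℕ) : ℕ → (Hm1 Ω →L[ℝ] H10 Ω)
  | 0 => resolventStep Ω a P μ m m
  | n + 1 => (resolventProd m n).comp
      ((embed Ω).comp (resolventStep Ω a P μ m (m - (n + 1))))

/-- `R̃_{m,l} = ∏_{j=1}^{m-l+1} r(k_{m+1-j} Ã_{k,m})`, for `1 ≤ l ≤ m`. -/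
def opRt (m l : ℕ) : Hm1 Ω →L[ℝ] H10 Ω := resolventProd Ω a P μ m (m - l)

/-- The defining expression of `(Q̃ g)_m`, as an element of `H⁻¹(Ω)`:
`∑_{l=1}^{m-1} k_l Ã_{k,m} R̃_{m,l} (Ã_{k,m} - Ã_{k,l}) Ã_{k,l}⁻¹ g_{k,l}`. -/
def QtExpr (g : P.X0 Ω) (m : ℕ) : Hm1 Ω :=
  ∑ l ∈ Finset.Ico 1 m, P.step l •
    opAt Ω a P μ m (opRt Ω a P μ m l
      ((opAt Ω a P μ m - opAt Ω a P μ l)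
        ((opAt Ω a P μ l).inverse (embed Ω (P.val g l)))))

/-- `Q` is the transformed perturbation operator `Q̃ : X_k^0 → X_k^0`: all the operators
that occur in its definition exist, and `(Q g)_m` is the element of `H¹₀(Ω)` which is given by
the defining expression. -/
structure IsQt (Q : P.X0 Ω →ₗ[ℝ] P.X0 Ω) : Prop where
  opA_apply : ∀ t ∈ Icc 0 T, ∀ u v : H10 Ω, opA Ω a t u v = aForm Ω a t u v
  integrable : ∀ m ∈ Finset.Icc 1 P.M, ∀ u v : H10 Ω,
    IntegrableOn (fun t => opA Ω a t u v) (P.interval m)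
  opAk_apply : ∀ m ∈ Finset.Icc 1 P.M, ∀ u v : H10 Ω,
    opAk Ω a P m u v = (P.step m)⁻¹ * ∫ t in P.interval m, opA Ω a t u v
  opAt_invertible : ∀ m ∈ Finset.Icc 1 P.M, (opAt Ω a P μ m).IsInvertible
  step_invertible : ∀ m ∈ Finset.Icc 1 P.M, ∀ j ∈ Finset.Icc 1 P.M,
    (embed Ω + P.step j • opAt Ω a P μ m).IsInvertible
  apply_eq : ∀ g, ∀ m ∈ Finset.Icc 1 P.M, embed Ω (P.val (Q g) m) = QtExpr Ω a P μ g m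

end Operators

/-- The norm `‖u‖_{L²(Ω)}` of `u ∈ H¹₀(Ω)`. -/
def l2norm {d : ℕ} {Ω : Set (E d)} (u : H10 Ω) : ℝ := ‖toL2 Ω u‖

end

end ParabolicDG

/-! `Q̃` is a discrete Volterra operator, strictly lower triangular in the interval index. It
suffices to bound the kernel from interval `l` to interval `m`, as a map on `L²`, by `f (t_m -
t_{l-1})` with `f` nonincreasing and `∫₀ᵀ f ≤ 3/4`. Row and column sums weighted with the steps are
then Riemann sums lying below the integral, which gives the maximum-norm and the `ℓ¹` estimate at
once (`volterra_bounds`).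

The smoothing estimate (`exists_smoothing`) is purely algebraic and needs no spectral theorem. With
`A = Ã_{k,m}`, `B = A⁻¹ Id` and `q = ∏ (X + k_i)`, one has `R̃ = Bʲ q(B)⁻¹ A⁻¹` for `j + 1` factors,
hence for `j ≥ 1` `A R̃ F = Id Bʲ⁻¹ ψ` with `q(B) ψ = A⁻¹ F`. All moments `⟨A Bⁱ ψ, ψ⟩` are
nonnegative, and so are the coefficients of `q`. In `⟨F, A⁻¹ F⟩ = ⟨A q(B)² ψ, ψ⟩` one may therefore
keep a single moment, the one equal to `‖Bʲ⁻¹ ψ‖²` in `L²`. Its coefficient is at least `2 e₁ e₂`,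
where `e₁ = s` is the sum of the steps and `e₂` is their second elementary symmetric polynomial.
Comparability of neighbouring steps gives `s² ≤ (2κ + 2) e₂`, so the operator costs `s^(-3/2)` from
the dual energy norm to `L²`.

The difference `Ã_{k,m} - Ã_{k,l}` is bounded on gradients by `ω(s)` plus a multiple of `μ |k_m -
k_l|`, and the `μ Id` term makes the gradient of `Ã_{k,l}⁻¹ g` of size `μ^(-1/2) ‖g‖`. Interpolating
`|k_m - k_l| ≤ ε⁴` with `|k_m - k_l| ≤ s` yields `ε s^(3/4)`. The majorant is thus `f(s) = c₁ ω(s)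
s^(-3/2) + c₂ s^(-3/4)` with `c₁ ~ μ^(-1/2)` and `c₂ ~ ε μ^(1/2)` (`AdmissibleCoeff.exists_kernel`).
A large `μ` makes the first integral small; then a small `ε`, depending on `μ`, does the same for
the second. -/

namespace ParabolicDG

open Polynomial

/-! ### Lax–Milgram and polynomial calculus in the energy form. -/

section Abstract

variable {V : Type*} [NormedAddCommGroup V] [InnerProductSpace ℝ V]

/-- The Lax–Milgram theorem for operators with values in the dual space. -/
theorem isInvertible_of_coercive [CompleteSpace V] {A : V →L[ℝ] StrongDual ℝ V} {γ : ℝ}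
    (hγ : 0 < γ) (hA : ∀ u, γ * ‖u‖ ^ 2 ≤ A u u) : A.IsInvertible := by
  have hco : IsCoercive A := ⟨γ, hγ, fun u => by simpa [pow_two, mul_assoc] using hA u⟩
  have hinj : Function.Injective A := by
    intro u v huv
    have h0 : A (u - v) = 0 := by rw [map_sub, huv, sub_self]
    have h1 := hA (u - v)
    rw [h0] at h1
    have h2 : ‖u - v‖ ^ 2 = 0 := by
      have := sq_nonneg ‖u - v‖
      have h3 : γ * ‖u - v‖ ^ 2 ≤ 0 := by simpa using h1
      nlinarith
    exact sub_eq_zero.1 (norm_eq_zero.1 (pow_eq_zero_iff two_ne_zero |>.1 h2))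
  have hsurj : Function.Surjective A := by
    intro f
    refine ⟨hco.continuousLinearEquivOfBilin.symm ((InnerProductSpace.toDual ℝ V).symm f), ?_⟩
    ext w
    rw [← hco.continuousLinearEquivOfBilin_apply]
    simp
  exact ⟨ContinuousLinearEquiv.ofBijective A (LinearMap.ker_eq_bot.2 hinj)
    (LinearMap.range_eq_top.2 hsurj), by ext; simp⟩

variable {A E : V →L[ℝ] StrongDual ℝ V} {B : V →L[ℝ] V}

/-- Since `A B = E` with `E` symmetric, `B` is self-adjoint for the form `A`; this passes to powers
and to linear combinations. -/
theorem form_aeval_symm (hA : ∀ u v, A u v = A v u) (hE : ∀ u v, E u v = E v u)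
    (hAB : ∀ u, A (B u) = E u) (q : ℝ[X]) (u v : V) :
    A (aeval B q u) v = A u (aeval B q v) := by
  have hB : ∀ u v, A (B u) v = A u (B v) := fun u v => by
    rw [hAB, hE, ← hAB, hA]
  have hpow : ∀ n : ℕ, ∀ u v, A ((B ^ n) u) v = A u ((B ^ n) v) := by
    intro n
    induction n with
    | zero => simp
    | succ n ih =>
      intro u v
      rw [pow_succ, mul_apply_eq_comp, ih, hB, ← mul_apply_eq_comp,
        ← pow_succ', pow_succ]
  induction q using Polynomial.induction_on' with
  | add p q hp hq => simp [hp, hq]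
  | monomial n r =>
    have h : ∀ w, aeval B (monomial n r) w = r • (B ^ n) w := fun w => by
      simp [aeval_monomial, Algebra.algebraMap_eq_smul_one]
    simp only [h, map_smul, smul_apply, hpow]

/-- Half of the powers of `B` move to the other argument: even powers leave a value of `A` on the
diagonal, odd ones a value of `A B = E`. -/
theorem form_pow_nonneg (hA : ∀ u v, A u v = A v u) (hE : ∀ u v, E u v = E v u)
    (hA0 : ∀ u, 0 ≤ A u u) (hE0 : ∀ u, 0 ≤ E u u)
    (hAB : ∀ u, A (B u) = E u) (n : ℕ) (u : V) : 0 ≤ A ((B ^ n) u) u := by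
  have hs : ∀ n : ℕ, ∀ u v, A ((B ^ n) u) v = A u ((B ^ n) v) := fun n u v => by
    simpa using form_aeval_symm hA hE hAB (X ^ n) u v
  obtain ⟨m, rfl | rfl⟩ := n.even_or_odd'
  · rw [two_mul, pow_add, mul_apply_eq_comp, hs]
    exact hA0 _
  · rw [add_comm, pow_add, two_mul, pow_add, pow_one, ← mul_assoc, ← pow_succ', pow_succ,
      mul_assoc, mul_apply_eq_comp, hs, mul_apply_eq_comp, hAB]
    exact hE0 _

/-- Expanding `q(B)` gives a sum of nonnegative moments with nonnegative coefficients, so any single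
term is a lower bound. -/
theorem coeff_mul_form_pow_le (hA : ∀ u v, A u v = A v u) (hE : ∀ u v, E u v = E v u)
    (hA0 : ∀ u, 0 ≤ A u u) (hE0 : ∀ u, 0 ≤ E u u) (hAB : ∀ u, A (B u) = E u)
    {q : ℝ[X]} (hq : ∀ i, 0 ≤ q.coeff i) (n : ℕ) (u : V) :
    q.coeff n * A ((B ^ n) u) u ≤ A (aeval B q u) u := by
  have h : A (aeval B q u) u
      = ∑ i ∈ Finset.range (max n q.natDegree + 1), q.coeff i * A ((B ^ i) u) u := by
    rw [aeval_eq_sum_range' (n := max n q.natDegree + 1)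
      (Nat.lt_succ_of_le (le_max_right _ _))]
    simp
  rw [h]
  exact Finset.single_le_sum (f := fun i => q.coeff i * A ((B ^ i) u) u)
    (fun i _ => mul_nonneg (hq i) (form_pow_nonneg hA hE hA0 hE0 hAB i u))
    (Finset.mem_range.2 (Nat.lt_succ_of_le (le_max_left _ _)))

/-- If `E = A B`, then `(E B^{n-1} u, B^{n-1} u)` is controlled by the `A`-norm of `q(B) u` for
each polynomial `q` with nonnegative coefficients. -/
theorem coeff_mul_form_le (hA : ∀ u v, A u v = A v u) (hE : ∀ u v, E u v = E v u)
    (hA0 : ∀ u, 0 ≤ A u u) (hE0 : ∀ u, 0 ≤ E u u) (hAB : ∀ u, A (B u) = E u)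
    {q : ℝ[X]} (hq : ∀ i, 0 ≤ q.coeff i) (n : ℕ) (u : V) :
    2 * (q.coeff (n + 1) * q.coeff n) * E ((B ^ n) u) ((B ^ n) u)
      ≤ A (aeval B q u) (aeval B q u) := by
  have h1 : E ((B ^ n) u) ((B ^ n) u) = A ((B ^ (n + 1 + n)) u) u := by
    have hs := form_aeval_symm hA hE hAB (X ^ n) ((B ^ (n + 1)) u) u
    simp only [map_pow, aeval_X] at hs
    rw [← hAB, ← mul_apply_eq_comp, ← pow_succ', ← hs, ← mul_apply_eq_comp,
      ← pow_add]
    congr 3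
    ring_nf
  have h2 : A (aeval B q u) (aeval B q u) = A (aeval B (q * q) u) u := by
    rw [← form_aeval_symm hA hE hAB, map_mul, mul_apply_eq_comp]
  have hqq : ∀ i, 0 ≤ (q * q).coeff i := fun i => by
    rw [coeff_mul]
    exact Finset.sum_nonneg fun x _ => mul_nonneg (hq _) (hq _)
  -- The coefficient of `X^(2n+1)` in `q²` receives `q_{n+1} q_n` twice, from the two pairs `(n + 1,
  -- n)` and `(n, n + 1)`.
  have h3 : 2 * (q.coeff (n + 1) * q.coeff n) ≤ (q * q).coeff (n + 1 + n) := by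
    rw [coeff_mul]
    have hsub : ({(n + 1, n), (n, n + 1)} : Finset (ℕ × ℕ)) ⊆ Finset.HasAntidiagonal.antidiagonal (n + 1 + n) := by
      intro x hx
      simp only [Finset.mem_insert, Finset.mem_singleton] at hx
      rcases hx with rfl | rfl
      · simp
      · simp; omega
    refine le_trans (le_of_eq ?_) (Finset.sum_le_sum_of_subset_of_nonneg hsub
      fun x _ _ => mul_nonneg (hq _) (hq _))
    rw [Finset.sum_pair (by simp)]
    ring
  rw [h1, h2]
  exact (mul_le_mul_of_nonneg_right h3 (form_pow_nonneg hA hE hA0 hE0 hAB _ u)).trans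
    (coeff_mul_form_pow_le hA hE hA0 hE0 hAB hqq _ u)

end Abstract

/-! ### Coefficients of a product of linear factors. -/

/-- `∏_{i ≤ n} (X + x_i)`. -/
noncomputable def shiftProd (x : ℕ → ℝ) : ℕ → ℝ[X]
  | 0 => X + C (x 0)
  | n + 1 => shiftProd x n * (X + C (x (n + 1)))

theorem coeff_mul_X_add_C_succ (p : ℝ[X]) (r : ℝ) (n : ℕ) :
    (p * (X + C r)).coeff (n + 1) = p.coeff n + p.coeff (n + 1) * r := by
  rw [mul_add, coeff_add, coeff_mul_X, coeff_mul_C]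

theorem coeff_mul_X_add_C_zero (p : ℝ[X]) (r : ℝ) :
    (p * (X + C r)).coeff 0 = p.coeff 0 * r := by
  rw [mul_add, coeff_add, coeff_mul_X_zero, coeff_mul_C, zero_add]

theorem shiftProd_coeff_nonneg {x : ℕ → ℝ} {n : ℕ} (hx : ∀ i ≤ n, 0 ≤ x i) (i : ℕ) :
    0 ≤ (shiftProd x n).coeff i := by
  induction n generalizing i with
  | zero =>
    rw [shiftProd, coeff_add, coeff_X, coeff_C]
    have := hx 0 le_rfl
    split_ifs <;> simp [this, add_nonneg]
  | succ n ih =>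
    have ih' := ih fun i hi => hx i (hi.trans n.le_succ)
    rw [shiftProd]
    cases i with
    | zero => rw [coeff_mul_X_add_C_zero]; exact mul_nonneg (ih' _) (hx _ le_rfl)
    | succ i =>
      rw [coeff_mul_X_add_C_succ]
      exact add_nonneg (ih' _) (mul_nonneg (ih' _) (hx _ le_rfl))

theorem natDegree_shiftProd_le (x : ℕ → ℝ) (n : ℕ) : (shiftProd x n).natDegree ≤ n + 1 := by
  induction n with
  | zero => simp [shiftProd]
  | succ n ih =>
    rw [shiftProd]
    refine natDegree_mul_le.trans ?_
    rw [natDegree_X_add_C]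
    omega

theorem shiftProd_coeff_self (x : ℕ → ℝ) (n : ℕ) : (shiftProd x n).coeff (n + 1) = 1 := by
  induction n with
  | zero => simp [shiftProd]
  | succ n ih =>
    have h : (shiftProd x n).coeff (n + 1 + 1) = 0 :=
      coeff_eq_zero_of_natDegree_lt (by have := natDegree_shiftProd_le x n; omega)
    rw [shiftProd, coeff_mul_X_add_C_succ, ih, h, zero_mul, add_zero]

theorem shiftProd_coeff_sum (x : ℕ → ℝ) (n : ℕ) :
    (shiftProd x n).coeff n = ∑ i ∈ Finset.range (n + 1), x i := by
  induction n with
  | zero => simp [shiftProd]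
  | succ n ih =>
    rw [shiftProd, coeff_mul_X_add_C_succ, ih, shiftProd_coeff_self x n, one_mul,
      ← Finset.sum_range_succ]

/-- If neighbouring `x_i` are comparable, the second elementary symmetric polynomial of
`x_0, …, x_{n+1}` is comparable to the square of their sum. -/
theorem sum_sq_le_shiftProd_coeff {x : ℕ → ℝ} {κ : ℝ} (hκ : 0 ≤ κ) {n : ℕ}
    (hx : ∀ i ≤ n + 1, 0 ≤ x i)
    (h1 : ∀ i ≤ n, x i ≤ κ * x (i + 1)) (h2 : ∀ i ≤ n, x (i + 1) ≤ κ * x i) :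
    (∑ i ∈ Finset.range (n + 2), x i) ^ 2 ≤ (2 * κ + 2) * (shiftProd x (n + 1)).coeff n := by
  induction n with
  | zero =>
    have e : (shiftProd x 1).coeff 0 = x 0 * x 1 := by
      rw [shiftProd, coeff_mul_X_add_C_zero]; simp [shiftProd]
    rw [e]
    simp only [zero_add, Finset.sum_range_succ, Finset.sum_range_zero]
    have := mul_le_mul_of_nonneg_left (h1 0 le_rfl) (hx 0 (by omega))
    have := mul_le_mul_of_nonneg_right (h2 0 le_rfl) (hx 1 (by omega))
    nlinarith
  | succ n ih =>
    have ih' := ih (fun i hi => hx i (by omega)) (fun i hi => h1 i (by omega))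
      (fun i hi => h2 i (by omega))
    -- A new `x = x_{n+2}` raises `e₂` by `s x` and the squared sum by `2 s x + x²`, where `x² ≤ κ s
    -- x` because `x ≤ κ x_{n+1} ≤ κ s`.
    rw [shiftProd, coeff_mul_X_add_C_succ, shiftProd_coeff_sum, Finset.sum_range_succ]
    set s := ∑ i ∈ Finset.range (n + 2), x i with hs
    have hle : x (n + 1) ≤ s := Finset.single_le_sum (f := x)
      (fun i hi => hx i (by have := Finset.mem_range.1 hi; omega)) (by simp)
    have hk : 0 ≤ x (n + 2) := hx _ le_rfl
    have h3 : x (n + 2) * x (n + 2) ≤ κ * s * x (n + 2) :=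
      mul_le_mul_of_nonneg_right ((h2 (n + 1) le_rfl).trans
        (mul_le_mul_of_nonneg_left hle hκ)) hk
    have h4 : 0 ≤ κ * (s * x (n + 2)) :=
      mul_nonneg hκ (mul_nonneg ((hx _ (by omega)).trans hle) hk)
    have e3 : n + 1 + 1 = n + 2 := rfl
    rw [e3]
    nlinarith


/-! ### Smoothing by products of resolvents. -/

section Smoothing

variable {d : ℕ} {Ω : Set (E d)}

theorem embed_apply_eq_inner (u v : H10 Ω) : embed Ω u v = inner ℝ (toL2 Ω u) (toL2 Ω v) := by
  simp [embed, real_inner_comm]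

theorem embed_symm (u v : H10 Ω) : embed Ω u v = embed Ω v u := by
  rw [embed_apply_eq_inner, embed_apply_eq_inner, real_inner_comm]

theorem embed_self (u : H10 Ω) : embed Ω u u = l2norm u ^ 2 := by
  rw [embed_apply_eq_inner, l2norm, real_inner_self_eq_norm_sq]

variable {a : Fin d → Fin d → ℝ → E d → ℝ} {T : ℝ} {P : TimeMesh T} {μ : ℝ} {m : ℕ}

/-- The product of resolvents in terms of the bounded operator `B = Ã⁻¹ Id` on `H¹₀(Ω)`. -/
theorem resolventProd_eq (hA : (opAt Ω a P μ m).IsInvertible) {B : H10 Ω →L[ℝ] H10 Ω}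
    (hB : B = (opAt Ω a P μ m).inverse ∘L embed Ω) (n : ℕ)
    (hG : ∀ i ≤ n, (embed Ω + P.step (m - i) • opAt Ω a P μ m).IsInvertible) :
    ∃ Z : H10 Ω →L[ℝ] H10 Ω, aeval B (shiftProd (fun i => P.step (m - i)) n) * Z = 1 ∧
      B * Z = Z * B ∧
      resolventProd Ω a P μ m n = (B ^ n * Z) ∘L (opAt Ω a P μ m).inverse := by
  set A := opAt Ω a P μ m with hAdef
  set S := A.inverse with hS
  -- From `A (B + r) = Id + r A`, each resolvent is `D A⁻¹` with `D = (B + r)⁻¹`; a two-sided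
  -- inverse of `B + r` commutes with `B`.
  have key : ∀ i ≤ n, ∃ D : H10 Ω →L[ℝ] H10 Ω,
      (B + P.step (m - i) • 1) * D = 1 ∧ B * D = D * B ∧
        resolventStep Ω a P μ m (m - i) = D ∘L S := by
    intro i hi
    set r := P.step (m - i) with hr
    set G := resolventStep Ω a P μ m (m - i) with hGdef
    have h1 : A ∘L (B + r • 1) = embed Ω + r • A := by
      ext u : 1
      simp [hB, hS, hA.self_apply_inverse]
    have h2 : (G ∘L A) * (B + r • 1) = 1 := by
      change (G ∘L A) ∘L (B + r • 1) = 1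
      rw [ContinuousLinearMap.comp_assoc, h1]
      exact (hG i hi).inverse_comp_self
    have h3 : (B + r • 1) * (G ∘L A) = 1 := by
      have h4 : B + r • 1 = S ∘L (embed Ω + r • A) := by
        ext u : 1
        simp [hB, hS, hA.inverse_apply_self]
      ext u : 1
      rw [h4]
      change S ((embed Ω + r • A) (G (A u))) = u
      rw [show (embed Ω + r • A) (G (A u)) = A u from (hG i hi).self_apply_inverse _]
      exact hA.inverse_apply_self u
    refine ⟨G ∘L A, h3, ?_, ?_⟩
    · set D := G ∘L A
      calc B * D = D * (B + r • 1) * (B * D) := by rw [h2, one_mul]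
        _ = D * B * ((B + r • 1) * D) := by
          simp only [mul_add, add_mul, mul_assoc, smul_mul_assoc, mul_smul_comm, one_mul]
        _ = D * B := by rw [h3, mul_one]
    · ext u : 1
      simp [hS, hA.self_apply_inverse]
  induction n with
  | zero =>
    obtain ⟨D, h1, h2, h3⟩ := key 0 le_rfl
    refine ⟨D, ?_, h2, ?_⟩
    · rw [← h1]; simp [shiftProd, Algebra.algebraMap_eq_smul_one]
    · rw [pow_zero, one_mul]; exact h3
  | succ n ih =>
    obtain ⟨Z, z1, z2, z3⟩ := ih (fun i hi => hG i (by omega)) (fun i hi => key i (by omega))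
    obtain ⟨D, h1, h2, h3⟩ := key (n + 1) le_rfl
    refine ⟨Z * D, ?_, ?_, ?_⟩
    · have h4 : aeval B (shiftProd (fun i => P.step (m - i)) (n + 1))
          = aeval B (shiftProd (fun i => P.step (m - i)) n) * (B + P.step (m - (n + 1)) • 1) := by
        simp [shiftProd, Algebra.algebraMap_eq_smul_one]
      have h5 : (B + P.step (m - (n + 1)) • 1) * Z = Z * (B + P.step (m - (n + 1)) • 1) := by
        simp [add_mul, mul_add, z2]
      rw [h4, mul_assoc, ← mul_assoc _ Z, h5, mul_assoc Z, h1, mul_one, z1]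
    · rw [← mul_assoc, z2, mul_assoc, h2, mul_assoc]
    · have h6 : resolventProd Ω a P μ m (n + 1)
          = (resolventProd Ω a P μ m n).comp
            ((embed Ω).comp (resolventStep Ω a P μ m (m - (n + 1)))) := rfl
      -- The `A⁻¹` ending the previous product meets the embedding in front of the new factor;
      -- together they form the additional power of `B`.
      rw [h6, z3, h3, pow_succ, mul_assoc (B ^ n), ← mul_assoc B, z2]
      ext u : 1
      simp only [ContinuousLinearMap.comp_apply, mul_apply_eq_comp]
      rw [hB]
      rfl

/-- The smoothing property `‖Ã R̃ F‖² ≤ (κ + 1) s⁻³ ⟨F, Ã⁻¹ F⟩` of a product `R̃` of at least two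
resolvents, where `s` is the sum of the steps. -/
theorem exists_smoothing (hA : (opAt Ω a P μ m).IsInvertible)
    (hsymm : ∀ u v, opAt Ω a P μ m u v = opAt Ω a P μ m v u)
    (hpos : ∀ u, 0 ≤ opAt Ω a P μ m u u) {κ : ℝ} (hκ : 0 ≤ κ) (n : ℕ)
    (hG : ∀ i ≤ n + 1, (embed Ω + P.step (m - i) • opAt Ω a P μ m).IsInvertible)
    (hx : ∀ i ≤ n + 1, 0 ≤ P.step (m - i))
    (h1 : ∀ i ≤ n, P.step (m - i) ≤ κ * P.step (m - (i + 1)))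
    (h2 : ∀ i ≤ n, P.step (m - (i + 1)) ≤ κ * P.step (m - i)) :
    ∃ W : Hm1 Ω →L[ℝ] H10 Ω, ∀ F,
      embed Ω (W F) = opAt Ω a P μ m (resolventProd Ω a P μ m (n + 1) F) ∧
      (∑ i ∈ Finset.range (n + 2), P.step (m - i)) ^ 3 * l2norm (W F) ^ 2
        ≤ (κ + 1) * F ((opAt Ω a P μ m).inverse F) := by
  set A := opAt Ω a P μ m with hAdef
  obtain ⟨Z, z1, z2, z3⟩ := resolventProd_eq hA rfl (n + 1) hG
  set B := A.inverse ∘L embed Ω with hB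
  have hAB : ∀ u, A (B u) = embed Ω u := fun u => hA.self_apply_inverse _
  set x : ℕ → ℝ := fun i => P.step (m - i) with hxdef
  -- The product of `n + 2` resolvents carries `B^(n+1)`; one power is spent on `A B = Id`, which
  -- puts `A R̃ F` in the range of the embedding.
  refine ⟨(B ^ n * Z) ∘L A.inverse, fun F => ⟨?_, ?_⟩⟩
  · rw [z3, pow_succ', mul_assoc]
    exact (hAB _).symm
  · set ψ := Z (A.inverse F) with hψ
    have hq : aeval B (shiftProd x (n + 1)) ψ = A.inverse F := by
      rw [hψ, ← mul_apply_eq_comp, z1]; rfl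
    have hc := shiftProd_coeff_nonneg hx
    have h4 := coeff_mul_form_le hsymm embed_symm hpos
      (fun u => by rw [embed_self]; positivity) hAB hc n ψ
    rw [hq, hA.self_apply_inverse, embed_self, shiftProd_coeff_sum] at h4
    have h5 := sum_sq_le_shiftProd_coeff hκ hx h1 h2
    have h6 : ((B ^ n * Z) ∘L A.inverse) F = (B ^ n) ψ := rfl
    rw [h6]
    have hs : 0 ≤ ∑ i ∈ Finset.range (n + 2), x i :=
      Finset.sum_nonneg fun i hi => hx i (by have := Finset.mem_range.1 hi; omega)
    change (∑ i ∈ Finset.range (n + 2), x i) ^ 3 * _ ≤ _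
    have e3 : n + 1 + 1 = n + 2 := rfl
    rw [e3] at h4
    set s := ∑ i ∈ Finset.range (n + 2), x i
    calc s ^ 3 * l2norm ((B ^ n) ψ) ^ 2 = s ^ 2 * (s * l2norm ((B ^ n) ψ) ^ 2) := by ring
      _ ≤ ((2 * κ + 2) * (shiftProd x (n + 1)).coeff n) * (s * l2norm ((B ^ n) ψ) ^ 2) :=
        mul_le_mul_of_nonneg_right h5 (by positivity)
      _ = (κ + 1) * (2 * (s * (shiftProd x (n + 1)).coeff n) * l2norm ((B ^ n) ψ) ^ 2) := by ring
      _ ≤ _ := mul_le_mul_of_nonneg_left h4 (by positivity)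

end Smoothing

/-! ### From almost every `(t, x)` to every `t`. -/

section Coefficients

variable {d : ℕ} {Ω : Set (E d)}

/-- A property which holds for almost all `(t, x)` and is given by inequalities between continuous
functions of `t` holds for almost all `x` and all `t`. -/
theorem ae_forall_Icc_nonneg {ι : Type*} {T : ℝ} (hT : 0 < T) {f : ι → ℝ → E d → ℝ}
    (h : ∀ᵐ p : ℝ × E d ∂(volume.restrict (Ioo 0 T ×ˢ Ω)), ∀ i, 0 ≤ f i p.1 p.2)
    (hc : ∀ᵐ x ∂(volume.restrict Ω), ∀ i, ContinuousOn (fun t => f i t x) (Icc 0 T)) :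
    ∀ᵐ x ∂(volume.restrict Ω), ∀ t ∈ Icc 0 T, ∀ i, 0 ≤ f i t x := by
  rw [Measure.volume_eq_prod, ← Measure.prod_restrict] at h
  have h1 := Measure.ae_ae_of_ae_prod ((Measure.measurePreserving_swap).quasiMeasurePreserving.ae h)
  filter_upwards [h1, hc] with x hx hcx t ht i
  -- Nonnegativity is written as `f = max f 0`, an equation between continuous functions of `t`, so
  -- that its validity for almost every `t` extends to the closed interval.
  have h2 : EqOn (fun t => f i t x) (fun t => max (f i t x) 0) (Icc 0 T) := by
    refine Measure.eqOn_Icc_of_ae_eq volume hT.ne ?_ (hcx i) ((hcx i).sup continuousOn_const)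
    rw [← restrict_Ioo_eq_restrict_Icc]
    filter_upwards [hx] with s hs
    exact (max_eq_left (hs i)).symm
  have h3 := h2 ht
  simp only at h3
  rw [h3]
  exact le_max_right _ _

variable {T α : ℝ} {om : ℝ → ℝ} {a : Fin d → Fin d → ℝ → E d → ℝ}

theorem AdmissibleCoeff.exists_bound (ha : AdmissibleCoeff Ω T α om a) (hT : 0 < T) :
    ∃ L : ℝ, 0 ≤ L ∧ ∀ i j, ∀ᵐ x ∂(volume.restrict Ω), ∀ t ∈ Icc 0 T, |a i j t x| ≤ L := by
  have h1 : ∀ i j, ∃ L : ℝ, 0 ≤ L ∧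
      ∀ᵐ x ∂(volume.restrict Ω), ∀ t ∈ Icc 0 T, |a i j t x| ≤ L := by
    intro i j
    set f := fun p : ℝ × E d => a i j p.1 p.2
    have hf := ha.bounded i j
    refine ⟨(eLpNorm f ⊤ (volume.restrict (Ioo 0 T ×ˢ Ω))).toReal, ENNReal.toReal_nonneg, ?_⟩
    set L := (eLpNorm f ⊤ (volume.restrict (Ioo 0 T ×ˢ Ω))).toReal
    have hb : ∀ᵐ p ∂(volume.restrict (Ioo 0 T ×ˢ Ω)), |f p| ≤ L := by
      filter_upwards [ae_le_eLpNormEssSup (f := f) (μ := volume.restrict (Ioo 0 T ×ˢ Ω))] with p hp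
      rw [← eLpNorm_exponent_top] at hp
      have := ENNReal.toReal_mono hf.eLpNorm_ne_top hp
      rwa [toReal_enorm, Real.norm_eq_abs] at this
    have := ae_forall_Icc_nonneg (ι := Unit) hT (f := fun _ t x => L - |a i j t x|)
      (by filter_upwards [hb] with p hp _; exact sub_nonneg.2 hp)
      (by
        filter_upwards [ha.continuous_time i j] with x hx _
        exact continuousOn_const.sub hx.abs)
    filter_upwards [this] with x hx t ht
    exact sub_nonneg.1 (hx t ht ())
  choose L hL0 hL using h1
  refine ⟨∑ i, ∑ j, L i j, Finset.sum_nonneg fun i _ => Finset.sum_nonneg fun j _ => hL0 i j,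
    fun i j => ?_⟩
  filter_upwards [hL i j] with x hx t ht
  refine (hx t ht).trans ?_
  exact (Finset.single_le_sum (f := fun j => L i j) (fun j _ => hL0 i j) (Finset.mem_univ j)).trans
    (Finset.single_le_sum (f := fun i => ∑ j, L i j)
      (fun i _ => Finset.sum_nonneg fun j _ => hL0 i j) (Finset.mem_univ i))

theorem AdmissibleCoeff.ae_symm (ha : AdmissibleCoeff Ω T α om a) (hT : 0 < T) (i j : Fin d) :
    ∀ᵐ x ∂(volume.restrict Ω), ∀ t ∈ Icc 0 T, a i j t x = a j i t x := by
  have hle : ∀ i j, ∀ᵐ x ∂(volume.restrict Ω), ∀ t ∈ Icc 0 T, a i j t x ≤ a j i t x := by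
    intro i j
    have := ae_forall_Icc_nonneg (ι := Unit) hT (f := fun _ t x => a j i t x - a i j t x)
      (by filter_upwards [ha.symmetric i j] with p hp _; exact sub_nonneg.2 hp.le)
      (by
        filter_upwards [ha.continuous_time i j, ha.continuous_time j i] with x hx hx' _
        exact hx'.sub hx)
    filter_upwards [this] with x hx t ht
    exact sub_nonneg.1 (hx t ht ())
  filter_upwards [hle i j, hle j i] with x h1 h2 t ht
  exact (h1 t ht).antisymm (h2 t ht)

theorem AdmissibleCoeff.ae_elliptic (ha : AdmissibleCoeff Ω T α om a) (hT : 0 < T) :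
    ∀ᵐ x ∂(volume.restrict Ω), ∀ t ∈ Icc 0 T, ∀ ξ : E d,
      α * ‖ξ‖ ^ 2 ≤ ∑ i, ∑ j, a i j t x * ξ i * ξ j := by
  have := ae_forall_Icc_nonneg (ι := E d) (Ω := Ω) hT
    (f := fun ξ t x => ∑ i, ∑ j, a i j t x * ξ i * ξ j - α * ‖ξ‖ ^ 2)
    (by filter_upwards [ha.elliptic] with p hp ξ; exact sub_nonneg.2 (hp ξ))
    (by
      have : ∀ᵐ x ∂(volume.restrict Ω), ∀ i j, ContinuousOn (fun t => a i j t x) (Icc 0 T) :=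
        ae_all_iff.2 fun i => ae_all_iff.2 fun j => ha.continuous_time i j
      filter_upwards [this] with x hx ξ
      refine ContinuousOn.sub ?_ continuousOn_const
      exact continuousOn_finsetSum _ fun i _ => continuousOn_finsetSum _ fun j _ =>
        ((hx i j).mul continuousOn_const).mul continuousOn_const)
  filter_upwards [this] with x hx t ht ξ
  exact sub_nonneg.1 (hx t ht ξ)

/-- Joint measurability gives measurable sections only for almost every time. Such times are dense,
and continuity in `t` exhibits any other section as an almost everywhere limit. -/
theorem AdmissibleCoeff.aestronglyMeasurable (ha : AdmissibleCoeff Ω T α om a) (hT : 0 < T)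
    (i j : Fin d) {t : ℝ} (ht : t ∈ Icc 0 T) :
    AEStronglyMeasurable (a i j t) (volume.restrict Ω) := by
  have h0 := (ha.bounded i j).aestronglyMeasurable
  rw [Measure.volume_eq_prod, ← Measure.prod_restrict] at h0
  have h1 := h0.prodMk_left
  rw [restrict_Ioo_eq_restrict_Icc (μ := volume), ae_restrict_iff' measurableSet_Icc] at h1
  set S := {s | s ∈ Icc 0 T → AEStronglyMeasurable (a i j s) (volume.restrict Ω)} with hS
  have hd : Dense S := Measure.dense_of_ae h1
  have hcl : t ∈ closure (Ioo 0 T ∩ S) := by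
    have := closure_mono (hd.open_subset_closure_inter (isOpen_Ioo (a := 0) (b := T)))
    rw [closure_closure, closure_Ioo hT.ne] at this
    exact this ht
  obtain ⟨u, hu, hut⟩ := mem_closure_iff_seq_limit.1 hcl
  refine aestronglyMeasurable_of_tendsto_ae Filter.atTop (f := fun n => a i j (u n))
    (fun n => (hu n).2 (Ioo_subset_Icc_self (hu n).1)) ?_
  filter_upwards [ha.continuous_time i j] with x hx
  exact (hx t ht).tendsto.comp (tendsto_nhdsWithin_iff.2
    ⟨hut, Filter.Eventually.of_forall fun n => Ioo_subset_Icc_self (hu n).1⟩)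

/-- Multiplication by a bounded measurable function in the scalar product of `L²`. -/
theorem integral_mul_mul_bound {X : Type*} [MeasurableSpace X] {ν : Measure X} {h : X → ℝ} {C : ℝ}
    (hm : AEStronglyMeasurable h ν) (hC : ∀ᵐ x ∂ν, |h x| ≤ C) (f g : Lp ℝ 2 ν) :
    Integrable (fun x => h x * f x * g x) ν ∧ |∫ x, h x * f x * g x ∂ν| ≤ C * ‖f‖ * ‖g‖ := by
  have hb : ∀ᵐ x ∂ν, ‖h x * f x‖ ≤ C * ‖f x‖ := by
    filter_upwards [hC] with x hx
    rw [norm_mul]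
    exact mul_le_mul_of_nonneg_right hx (norm_nonneg _)
  have hmem : MemLp (fun x => h x * f x) 2 ν :=
    (Lp.memLp f).of_le_mul (hm.mul (Lp.aestronglyMeasurable f)) hb
  have hn : ‖hmem.toLp _‖ ≤ C * ‖f‖ := by
    refine Lp.norm_le_mul_norm_of_ae_le_mul ?_
    filter_upwards [hb, hmem.coeFn_toLp] with x hx hx'
    rwa [hx']
  have he : (fun x => h x * f x * g x) =ᵐ[ν] fun x => inner ℝ (hmem.toLp _ x) (g x) := by
    filter_upwards [hmem.coeFn_toLp] with x hx
    rw [hx]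
    simp [mul_comm]
  refine ⟨(L2.integrable_inner (𝕜 := ℝ) _ g).congr he.symm, ?_⟩
  rw [integral_congr_ae he, ← L2.inner_def]
  exact (abs_real_inner_le_norm _ _).trans (mul_le_mul_of_nonneg_right hn (norm_nonneg _))

end Coefficients

/-! ### Bilinear forms with bounded coefficients on `H10 Ω`. -/

section Form

variable {d : ℕ} {Ω : Set (E d)}

/-- `‖∇u‖_{L²(Ω)}` -/
noncomputable def gradNorm (u : H10 Ω) : ℝ := Real.sqrt (∑ i, ‖partialDeriv Ω i u‖ ^ 2)

theorem gradNorm_nonneg (u : H10 Ω) : 0 ≤ gradNorm u := Real.sqrt_nonneg _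

theorem gradNorm_sq (u : H10 Ω) : gradNorm u ^ 2 = ∑ i, ‖partialDeriv Ω i u‖ ^ 2 :=
  Real.sq_sqrt (Finset.sum_nonneg fun _ _ => sq_nonneg _)

theorem norm_partialDeriv_le (i : Fin d) (u : H10 Ω) : ‖partialDeriv Ω i u‖ ≤ gradNorm u :=
  Real.le_sqrt_of_sq_le (Finset.single_le_sum (f := fun i => ‖partialDeriv Ω i u‖ ^ 2)
    (fun _ _ => sq_nonneg _) (Finset.mem_univ i))

theorem norm_sq_eq (u : H10 Ω) : ‖u‖ ^ 2 = l2norm u ^ 2 + gradNorm u ^ 2 := by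
  have h : ‖u‖ = ‖toJet Ω u‖ := rfl
  rw [h, PiLp.norm_sq_eq_of_L2, Fintype.sum_option, gradNorm_sq]
  rfl

theorem gradNorm_le_norm (u : H10 Ω) : gradNorm u ≤ ‖u‖ :=
  le_of_sq_le_sq (by rw [norm_sq_eq]; nlinarith [sq_nonneg (l2norm u)]) (norm_nonneg _)

theorem l2norm_nonneg (u : H10 Ω) : 0 ≤ l2norm u := norm_nonneg _

/-- The defining property of `opOfForm` for a bounded bilinear form. -/
theorem opOfForm_apply {b : H10 Ω → H10 Ω → ℝ} {C : ℝ}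
    (h1 : ∀ (r : ℝ) u u' v, b (r • u + u') v = r * b u v + b u' v)
    (h2 : ∀ (r : ℝ) u u' v, b v (r • u + u') = r * b v u + b v u')
    (h3 : ∀ u v, |b u v| ≤ C * gradNorm u * gradNorm v) (hC : 0 ≤ C) (u v : H10 Ω) :
    opOfForm b u v = b u v := by
  have h : ∃ B : H10 Ω →L[ℝ] Hm1 Ω, ∀ u v, B u v = b u v := by
    have z1 : ∀ v, b 0 v = 0 := fun v => by simpa using h1 1 0 0 v
    have z2 : ∀ v, b v 0 = 0 := fun v => by simpa using h2 1 0 0 v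
    refine ⟨LinearMap.mkContinuous₂ (LinearMap.mk₂ ℝ b (fun u u' v => by simpa using h1 1 u u' v)
      (fun r u v => by simpa [z1] using h1 r u 0 v) (fun u v v' => by simpa using h2 1 v v' u)
      (fun r u v => by simpa [z2] using h2 r v 0 u)) C fun u v => ?_, fun u v => rfl⟩
    refine (h3 u v).trans ?_
    have := gradNorm_le_norm u
    have := gradNorm_le_norm v
    have := gradNorm_nonneg u
    have := gradNorm_nonneg v
    gcongr
  rw [opOfForm, dif_pos h]
  exact h.choose_spec u v

theorem abs_sum_sum_le {F : Fin d → Fin d → ℝ} {C : ℝ} (hC : 0 ≤ C) {u v : H10 Ω}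
    (hF : ∀ i j, |F i j| ≤ C * ‖partialDeriv Ω i u‖ * ‖partialDeriv Ω j v‖) :
    |∑ i, ∑ j, F i j| ≤ d ^ 2 * C * gradNorm u * gradNorm v := by
  have h : ∀ i j, |F i j| ≤ C * gradNorm u * gradNorm v := fun i j => by
    refine (hF i j).trans ?_
    have := norm_partialDeriv_le i u
    have := norm_partialDeriv_le j v
    have := gradNorm_nonneg u
    gcongr
  calc |∑ i, ∑ j, F i j| ≤ ∑ i, ∑ j, |F i j| := (Finset.abs_sum_le_sum_abs _ _).trans
        (Finset.sum_le_sum fun i _ => Finset.abs_sum_le_sum_abs _ _)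
    _ ≤ ∑ _i : Fin d, ∑ _j : Fin d, C * gradNorm u * gradNorm v :=
        Finset.sum_le_sum fun i _ => Finset.sum_le_sum fun j _ => h i j
    _ = _ := by simp; ring

/-- The form with bounded measurable coefficients. -/
theorem integral_form {c : Fin d → Fin d → E d → ℝ} {C : ℝ}
    (hm : ∀ i j, AEStronglyMeasurable (c i j) (volume.restrict Ω))
    (hC : ∀ i j, ∀ᵐ x ∂(volume.restrict Ω), |c i j x| ≤ C) (u v : H10 Ω) :
    ∫ x in Ω, ∑ i, ∑ j, c i j x * partialDeriv Ω i u x * partialDeriv Ω j v x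
      = ∑ i, ∑ j, ∫ x in Ω, c i j x * partialDeriv Ω i u x * partialDeriv Ω j v x := by
  have hi : ∀ i j, Integrable (fun x => c i j x * partialDeriv Ω i u x * partialDeriv Ω j v x)
      (volume.restrict Ω) := fun i j => (integral_mul_mul_bound (hm i j) (hC i j) _ _).1
  rw [integral_finsetSum _ fun i _ => integrable_finsetSum _ fun j _ => hi i j]
  exact Finset.sum_congr rfl fun i _ => integral_finsetSum _ fun j _ => hi i j

theorem integral_form_bound {c : Fin d → Fin d → E d → ℝ} {C : ℝ} (hC0 : 0 ≤ C)
    (hm : ∀ i j, AEStronglyMeasurable (c i j) (volume.restrict Ω))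
    (hC : ∀ i j, ∀ᵐ x ∂(volume.restrict Ω), |c i j x| ≤ C) (u v : H10 Ω) :
    |∫ x in Ω, ∑ i, ∑ j, c i j x * partialDeriv Ω i u x * partialDeriv Ω j v x|
      ≤ d ^ 2 * C * gradNorm u * gradNorm v := by
  rw [integral_form hm hC]
  exact abs_sum_sum_le hC0 fun i j => (integral_mul_mul_bound (hm i j) (hC i j) _ _).2

/-- The form is bilinear. -/
theorem integral_form_add {c : Fin d → Fin d → E d → ℝ} {C : ℝ}
    (hm : ∀ i j, AEStronglyMeasurable (c i j) (volume.restrict Ω))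
    (hC : ∀ i j, ∀ᵐ x ∂(volume.restrict Ω), |c i j x| ≤ C) (r : ℝ) (u u' v : H10 Ω) :
    (∫ x in Ω, ∑ i, ∑ j, c i j x * partialDeriv Ω i (r • u + u') x * partialDeriv Ω j v x
      = r * (∫ x in Ω, ∑ i, ∑ j, c i j x * partialDeriv Ω i u x * partialDeriv Ω j v x)
        + ∫ x in Ω, ∑ i, ∑ j, c i j x * partialDeriv Ω i u' x * partialDeriv Ω j v x) ∧
    (∫ x in Ω, ∑ i, ∑ j, c i j x * partialDeriv Ω i v x * partialDeriv Ω j (r • u + u') x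
      = r * (∫ x in Ω, ∑ i, ∑ j, c i j x * partialDeriv Ω i v x * partialDeriv Ω j u x)
        + ∫ x in Ω, ∑ i, ∑ j, c i j x * partialDeriv Ω i v x * partialDeriv Ω j u' x) := by
  have hi : ∀ (u v : H10 Ω) i j,
      Integrable (fun x => c i j x * partialDeriv Ω i u x * partialDeriv Ω j v x)
      (volume.restrict Ω) := fun u v i j => (integral_mul_mul_bound (hm i j) (hC i j) _ _).1
  have he : ∀ i, (partialDeriv Ω i (r • u + u') : E d → ℝ) =ᵐ[volume.restrict Ω]
      fun x => r * partialDeriv Ω i u x + partialDeriv Ω i u' x := fun i => by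
    rw [map_add, map_smul]
    filter_upwards [Lp.coeFn_add (r • partialDeriv Ω i u) (partialDeriv Ω i u'),
      Lp.coeFn_smul r (partialDeriv Ω i u)] with x h1 h2
    rw [h1, Pi.add_apply, h2]; rfl
  simp only [integral_form hm hC, Finset.mul_sum, ← Finset.sum_add_distrib]
  constructor <;> refine Finset.sum_congr rfl fun i _ => Finset.sum_congr rfl fun j _ => ?_
  · rw [← integral_const_mul, ← integral_add ((hi u v i j).const_mul r) (hi u' v i j)]
    refine integral_congr_ae ?_
    filter_upwards [he i] with x hx
    rw [hx]; ring
  · rw [← integral_const_mul, ← integral_add ((hi v u i j).const_mul r) (hi v u' i j)]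
    refine integral_congr_ae ?_
    filter_upwards [he j] with x hx
    rw [hx]; ring

end Form

/-! ### The forms of the operators `A(t)`. -/

section AForm

variable {d : ℕ} {Ω : Set (E d)} {T α L : ℝ} {om : ℝ → ℝ} {a : Fin d → Fin d → ℝ → E d → ℝ}

theorem AdmissibleCoeff.abs_aForm_le (ha : AdmissibleCoeff Ω T α om a) (hT : 0 < T) (hL0 : 0 ≤ L)
    (hL : ∀ i j, ∀ᵐ x ∂(volume.restrict Ω), ∀ t ∈ Icc 0 T, |a i j t x| ≤ L) {t : ℝ}
    (ht : t ∈ Icc 0 T) (u v : H10 Ω) :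
    |aForm Ω a t u v| ≤ d ^ 2 * L * gradNorm u * gradNorm v :=
  integral_form_bound hL0 (fun i j => ha.aestronglyMeasurable hT i j ht)
    (fun i j => (hL i j).mono fun _ hx => hx t ht) u v

theorem AdmissibleCoeff.aForm_add (ha : AdmissibleCoeff Ω T α om a) (hT : 0 < T) {t : ℝ}
    (ht : t ∈ Icc 0 T) (r : ℝ) (u u' v : H10 Ω) :
    aForm Ω a t (r • u + u') v = r * aForm Ω a t u v + aForm Ω a t u' v ∧
    aForm Ω a t v (r • u + u') = r * aForm Ω a t v u + aForm Ω a t v u' := by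
  obtain ⟨L, _, hL⟩ := ha.exists_bound hT
  exact integral_form_add (fun i j => ha.aestronglyMeasurable hT i j ht)
    (fun i j => (hL i j).mono fun _ hx => hx t ht) r u u' v

theorem AdmissibleCoeff.opA_apply (ha : AdmissibleCoeff Ω T α om a) (hT : 0 < T) {t : ℝ}
    (ht : t ∈ Icc 0 T) (u v : H10 Ω) : opA Ω a t u v = aForm Ω a t u v := by
  obtain ⟨L, hL0, hL⟩ := ha.exists_bound hT
  exact opOfForm_apply (fun r u u' v => (ha.aForm_add hT ht r u u' v).1)
    (fun r u u' v => (ha.aForm_add hT ht r u u' v).2) (ha.abs_aForm_le hT hL0 hL ht)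
    (by positivity) u v

theorem AdmissibleCoeff.aForm_symm (ha : AdmissibleCoeff Ω T α om a) (hT : 0 < T) {t : ℝ}
    (ht : t ∈ Icc 0 T) (u v : H10 Ω) : aForm Ω a t u v = aForm Ω a t v u := by
  have h : ∀ᵐ x ∂(volume.restrict Ω), ∀ i j, a i j t x = a j i t x :=
    ae_all_iff.2 fun i => ae_all_iff.2 fun j => (ha.ae_symm hT i j).mono fun x hx => hx t ht
  refine integral_congr_ae ?_
  filter_upwards [h] with x hx
  rw [Finset.sum_comm]
  refine Finset.sum_congr rfl fun i _ => Finset.sum_congr rfl fun j _ => ?_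
  rw [hx]; ring

theorem AdmissibleCoeff.le_aForm_self (ha : AdmissibleCoeff Ω T α om a) (hT : 0 < T) {t : ℝ}
    (ht : t ∈ Icc 0 T) (u : H10 Ω) : α * gradNorm u ^ 2 ≤ aForm Ω a t u u := by
  obtain ⟨L, hL0, hL⟩ := ha.exists_bound hT
  have hsq : ∀ i, Integrable (fun x => partialDeriv Ω i u x ^ 2) (volume.restrict Ω) := fun i =>
    (Lp.memLp (partialDeriv Ω i u)).integrable_sq
  have h1 : α * gradNorm u ^ 2 = ∫ x in Ω, α * ∑ i, partialDeriv Ω i u x ^ 2 := by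
    rw [integral_const_mul, integral_finsetSum _ fun i _ => hsq i, gradNorm_sq]
    congr 1
    refine Finset.sum_congr rfl fun i _ => ?_
    rw [← real_inner_self_eq_norm_sq, L2.inner_def]
    simp [pow_two]
  rw [h1]
  refine integral_mono_ae ((integrable_finsetSum _ fun i _ => hsq i).const_mul α)
    (integrable_finsetSum _ fun i _ => integrable_finsetSum _ fun j _ =>
      (integral_mul_mul_bound (ha.aestronglyMeasurable hT i j ht)
        ((hL i j).mono fun _ hx => hx t ht) _ _).1) ?_
  filter_upwards [ha.ae_elliptic hT] with x hx
  have := hx t ht (WithLp.toLp 2 fun i => partialDeriv Ω i u x)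
  simpa [EuclideanSpace.norm_sq_eq] using this

theorem AdmissibleCoeff.abs_aForm_sub_le (ha : AdmissibleCoeff Ω T α om a) (hT : 0 < T) {t s : ℝ}
    (ht : t ∈ Icc 0 T) (hs : s ∈ Icc 0 T) (u v : H10 Ω) :
    |aForm Ω a t u v - aForm Ω a s u v| ≤ d ^ 2 * om |t - s| * gradNorm u * gradNorm v := by
  obtain ⟨L, hL0, hL⟩ := ha.exists_bound hT
  have hint : ∀ r ∈ Icc 0 T, Integrable (fun x => ∑ i, ∑ j,
      a i j r x * partialDeriv Ω i u x * partialDeriv Ω j v x) (volume.restrict Ω) := fun r hr =>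
    integrable_finsetSum _ fun i _ => integrable_finsetSum _ fun j _ =>
      (integral_mul_mul_bound (ha.aestronglyMeasurable hT i j hr)
        ((hL i j).mono fun _ hx => hx r hr) _ _).1
  have h1 : aForm Ω a t u v - aForm Ω a s u v = ∫ x in Ω, ∑ i, ∑ j,
      (a i j t x - a i j s x) * partialDeriv Ω i u x * partialDeriv Ω j v x := by
    rw [aForm, aForm, ← integral_sub (hint t ht) (hint s hs)]
    refine integral_congr_ae (Filter.Eventually.of_forall fun x => ?_)
    simp only [← Finset.sum_sub_distrib, sub_mul]
  rw [h1]
  have h2 : |t - s| ∈ Icc 0 T :=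
    ⟨abs_nonneg _, abs_sub_le_of_nonneg_of_le ht.1 ht.2 hs.1 hs.2⟩
  exact integral_form_bound (ha.omega_nonneg _ h2)
    (fun i j => (ha.aestronglyMeasurable hT i j ht).sub (ha.aestronglyMeasurable hT i j hs))
    (fun i j => ha.modulus i j t ht s hs) u v

theorem AdmissibleCoeff.continuousOn_aForm (ha : AdmissibleCoeff Ω T α om a) (hT : 0 < T)
    (u v : H10 Ω) : ContinuousOn (fun t => aForm Ω a t u v) (Icc 0 T) := by
  obtain ⟨L, hL0, hL⟩ := ha.exists_bound hT
  have hc : ContinuousOn (fun t => ∑ i, ∑ j, ∫ x in Ω,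
      a i j t x * partialDeriv Ω i u x * partialDeriv Ω j v x) (Icc 0 T) := by
    refine continuousOn_finsetSum _ fun i _ => continuousOn_finsetSum _ fun j _ => ?_
    refine continuousOn_of_dominated
      (bound := fun x => L * ‖partialDeriv Ω i u x * partialDeriv Ω j v x‖)
      (fun t ht => (integral_mul_mul_bound (ha.aestronglyMeasurable hT i j ht)
        ((hL i j).mono fun _ hx => hx t ht) _ _).1.aestronglyMeasurable) ?_ ?_ ?_
    · intro t ht
      filter_upwards [hL i j] with x hx
      rw [mul_assoc, norm_mul]
      exact mul_le_mul_of_nonneg_right (hx t ht) (norm_nonneg _)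
    · have := (integral_mul_mul_bound (ν := volume.restrict Ω) (h := fun _ => 1) (C := 1)
        aestronglyMeasurable_const (by simp) (partialDeriv Ω i u) (partialDeriv Ω j v)).1
      simp only [one_mul] at this
      exact this.norm.const_mul L
    · filter_upwards [ha.continuous_time i j] with x hx
      exact (hx.mul continuousOn_const).mul continuousOn_const
  refine hc.congr fun t ht => ?_
  exact integral_form (fun i j => ha.aestronglyMeasurable hT i j ht)
    (fun i j => (hL i j).mono fun _ hx => hx t ht) u v

end AForm

/-! ### Averages over mesh intervals. -/

namespace TimeMesh

variable {T : ℝ} (P : TimeMesh T)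

theorem t_le {i j : ℕ} (hij : i ≤ j) (hj : j ≤ P.M) : P.t i ≤ P.t j := by
  induction j, hij using Nat.le_induction with
  | base => exact le_rfl
  | succ j hij ih => exact (ih (by omega)).trans (P.t_lt j (by omega)).le

theorem step_pos {m : ℕ} (h1 : 1 ≤ m) (hm : m ≤ P.M) : 0 < P.step m := by
  have := P.t_lt (m - 1) (by omega)
  rw [Nat.sub_add_cancel h1] at this
  exact sub_pos.2 this

theorem t_mem {m : ℕ} (hm : m ≤ P.M) : P.t m ∈ Icc 0 T :=
  ⟨P.t_zero.ge.trans (P.t_le (Nat.zero_le m) hm), (P.t_le hm le_rfl).trans P.t_last.le⟩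

theorem interval_subset {m : ℕ} (hm : m ≤ P.M) : P.interval m ⊆ Icc 0 T := fun _ ht =>
  ⟨(P.t_mem ((Nat.sub_le m 1).trans hm)).1.trans ht.1.le, ht.2.trans (P.t_mem hm).2⟩

theorem measurableSet_interval (m : ℕ) : MeasurableSet (P.interval m) := measurableSet_Ioc

theorem volume_interval {m : ℕ} (hm : m ≤ P.M) :
    volume.real (P.interval m) = P.step m := by
  rw [interval, Real.volume_real_Ioc_of_le (P.t_le (Nat.sub_le m 1) hm)]; rfl

/-- If `f` is close to `r` on `I_m`, then so is its mean value. -/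
theorem abs_sub_average_le {m : ℕ} (h1 : 1 ≤ m) (hm : m ≤ P.M) {f : ℝ → ℝ} {r C : ℝ}
    (hf : IntegrableOn f (P.interval m)) (h : ∀ t ∈ P.interval m, |r - f t| ≤ C) :
    |r - (P.step m)⁻¹ * ∫ t in P.interval m, f t| ≤ C := by
  have hk := P.step_pos h1 hm
  have hfin : volume (P.interval m) < ⊤ := measure_Ioc_lt_top
  have h2 : |∫ t in P.interval m, (r - f t)| ≤ C * volume.real (P.interval m) :=
    norm_setIntegral_le_of_norm_le_const (f := fun t => r - f t) hfin h
  have hc : IntegrableOn (fun _ => r) (P.interval m) := integrableOn_const hfin.ne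
  rw [integral_sub hc hf, setIntegral_const, P.volume_interval hm,
    smul_eq_mul] at h2
  have h3 : r - (P.step m)⁻¹ * ∫ t in P.interval m, f t
      = (P.step m)⁻¹ * (P.step m * r - ∫ t in P.interval m, f t) := by
    field_simp
  rw [h3, abs_mul, abs_of_pos (inv_pos.2 hk), inv_mul_le_iff₀ hk]
  exact h2.trans (by rw [mul_comm])

theorem le_average {m : ℕ} (h1 : 1 ≤ m) (hm : m ≤ P.M) {f : ℝ → ℝ} {r : ℝ}
    (hf : IntegrableOn f (P.interval m)) (h : ∀ t ∈ P.interval m, r ≤ f t) :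
    r ≤ (P.step m)⁻¹ * ∫ t in P.interval m, f t := by
  have hk := P.step_pos h1 hm
  have hfin : volume (P.interval m) < ⊤ := measure_Ioc_lt_top
  have h2 := setIntegral_mono_on (integrableOn_const hfin.ne) hf measurableSet_Ioc h
  rw [setIntegral_const, P.volume_interval hm, smul_eq_mul] at h2
  rwa [le_inv_mul_iff₀ hk]

end TimeMesh

/-! ### The averaged operators `A_{k,m}`. -/

section OpAk

variable {d : ℕ} {Ω : Set (E d)} {T α L : ℝ} {om : ℝ → ℝ} {a : Fin d → Fin d → ℝ → E d → ℝ}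
  (P : TimeMesh T) {m l : ℕ}

theorem AdmissibleCoeff.integrableOn_aForm (ha : AdmissibleCoeff Ω T α om a) (hT : 0 < T)
    (hm : m ≤ P.M) (u v : H10 Ω) : IntegrableOn (fun t => aForm Ω a t u v) (P.interval m) :=
  (ha.continuousOn_aForm hT u v).integrableOn_Icc.mono_set (P.interval_subset hm)

theorem AdmissibleCoeff.integral_opA (ha : AdmissibleCoeff Ω T α om a) (hT : 0 < T)
    (hm : m ≤ P.M) (u v : H10 Ω) :
    ∫ t in P.interval m, opA Ω a t u v = ∫ t in P.interval m, aForm Ω a t u v :=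
  setIntegral_congr_fun (P.measurableSet_interval m) fun _ ht =>
    ha.opA_apply hT (P.interval_subset hm ht) u v

theorem AdmissibleCoeff.opAk_apply (ha : AdmissibleCoeff Ω T α om a) (hT : 0 < T)
    (h1 : 1 ≤ m) (hm : m ≤ P.M) (u v : H10 Ω) :
    opAk Ω a P m u v = (P.step m)⁻¹ * ∫ t in P.interval m, opA Ω a t u v := by
  obtain ⟨L, hL0, hL⟩ := ha.exists_bound hT
  refine opOfForm_apply (C := d ^ 2 * L) ?_ ?_ ?_ (by positivity) u v
  · intro r u u' v
    simp only [ha.integral_opA P hT hm]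
    rw [setIntegral_congr_fun (P.measurableSet_interval m) fun t ht =>
      (ha.aForm_add hT (P.interval_subset hm ht) r u u' v).1,
      integral_add ((ha.integrableOn_aForm P hT hm u v).const_mul r)
        (ha.integrableOn_aForm P hT hm u' v), integral_const_mul]
    ring
  · intro r u u' v
    simp only [ha.integral_opA P hT hm]
    rw [setIntegral_congr_fun (P.measurableSet_interval m) fun t ht =>
      (ha.aForm_add hT (P.interval_subset hm ht) r u u' v).2,
      integral_add ((ha.integrableOn_aForm P hT hm v u).const_mul r)
        (ha.integrableOn_aForm P hT hm v u'), integral_const_mul]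
    ring
  · intro u v
    have := P.abs_sub_average_le h1 hm (r := 0) (ha.integrableOn_aForm P hT hm u v)
      (fun t ht => by
        rw [zero_sub, abs_neg]
        exact ha.abs_aForm_le hT hL0 hL (P.interval_subset hm ht) u v)
    rwa [zero_sub, abs_neg, ← ha.integral_opA P hT hm] at this

theorem AdmissibleCoeff.opAk_eq (ha : AdmissibleCoeff Ω T α om a) (hT : 0 < T)
    (h1 : 1 ≤ m) (hm : m ≤ P.M) (u v : H10 Ω) :
    opAk Ω a P m u v = (P.step m)⁻¹ * ∫ t in P.interval m, aForm Ω a t u v := by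
  rw [ha.opAk_apply P hT h1 hm, ha.integral_opA P hT hm]

theorem AdmissibleCoeff.opAk_symm (ha : AdmissibleCoeff Ω T α om a) (hT : 0 < T)
    (h1 : 1 ≤ m) (hm : m ≤ P.M) (u v : H10 Ω) : opAk Ω a P m u v = opAk Ω a P m v u := by
  rw [ha.opAk_eq P hT h1 hm, ha.opAk_eq P hT h1 hm,
    setIntegral_congr_fun (P.measurableSet_interval m) fun t ht =>
      ha.aForm_symm hT (P.interval_subset hm ht) u v]

theorem AdmissibleCoeff.abs_opAk_le (ha : AdmissibleCoeff Ω T α om a) (hT : 0 < T) (hL0 : 0 ≤ L)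
    (hL : ∀ i j, ∀ᵐ x ∂(volume.restrict Ω), ∀ t ∈ Icc 0 T, |a i j t x| ≤ L)
    (h1 : 1 ≤ m) (hm : m ≤ P.M) (u v : H10 Ω) :
    |opAk Ω a P m u v| ≤ d ^ 2 * L * gradNorm u * gradNorm v := by
  have := P.abs_sub_average_le h1 hm (r := 0) (ha.integrableOn_aForm P hT hm u v)
    (fun t ht => by
      rw [zero_sub, abs_neg]
      exact ha.abs_aForm_le hT hL0 hL (P.interval_subset hm ht) u v)
  rwa [zero_sub, abs_neg, ← ha.opAk_eq P hT h1 hm] at this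

theorem AdmissibleCoeff.le_opAk_self (ha : AdmissibleCoeff Ω T α om a) (hT : 0 < T)
    (h1 : 1 ≤ m) (hm : m ≤ P.M) (u : H10 Ω) : α * gradNorm u ^ 2 ≤ opAk Ω a P m u u := by
  rw [ha.opAk_eq P hT h1 hm]
  exact P.le_average h1 hm (ha.integrableOn_aForm P hT hm u u)
    fun t ht => ha.le_aForm_self hT (P.interval_subset hm ht) u

/-- Two times in `I_l` and `I_m` are at most `t_m - t_{l-1}` apart and `om` is monotone; averaging
in each variable preserves the bound. -/
theorem AdmissibleCoeff.abs_opAk_sub_le (ha : AdmissibleCoeff Ω T α om a) (hT : 0 < T)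
    (hl : 1 ≤ l) (hlm : l ≤ m) (hm : m ≤ P.M) (u v : H10 Ω) :
    |opAk Ω a P m u v - opAk Ω a P l u v|
      ≤ d ^ 2 * om (P.t m - P.t (l - 1)) * gradNorm u * gradNorm v := by
  have hb : ∀ t ∈ P.interval l, ∀ s ∈ P.interval m, |aForm Ω a t u v - aForm Ω a s u v|
      ≤ d ^ 2 * om (P.t m - P.t (l - 1)) * gradNorm u * gradNorm v := by
    intro t ht s hs
    have ht' := P.interval_subset (hlm.trans hm) ht
    have hs' := P.interval_subset hm hs
    have h1 := P.t_le (show l - 1 ≤ m - 1 by omega) (by omega)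
    have h2 := P.t_le hlm hm
    have h3 := P.t_mem (m := l - 1) (by omega)
    have h4 := P.t_mem hm
    have h0 : |t - s| ≤ P.t m - P.t (l - 1) := by
      rw [abs_le]
      constructor <;> linarith [ht.1, ht.2, hs.1, hs.2]
    have h6 : P.t m - P.t (l - 1) ≤ T := by linarith [h3.1, h4.2]
    have h5 : om |t - s| ≤ om (P.t m - P.t (l - 1)) :=
      ha.omega_mono ⟨abs_nonneg _, h0.trans h6⟩ ⟨(abs_nonneg _).trans h0, h6⟩ h0
    refine (ha.abs_aForm_sub_le hT ht' hs' u v).trans ?_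
    have := gradNorm_nonneg u
    have := gradNorm_nonneg v
    gcongr
  rw [abs_sub_comm, ha.opAk_eq P hT (hl.trans hlm) hm]
  refine P.abs_sub_average_le (hl.trans hlm) hm (ha.integrableOn_aForm P hT hm u v) fun s hs => ?_
  rw [abs_sub_comm, ha.opAk_eq P hT hl (hlm.trans hm)]
  refine P.abs_sub_average_le hl (hlm.trans hm)
    (ha.integrableOn_aForm P hT (hlm.trans hm) u v) fun t ht => ?_
  rw [abs_sub_comm]
  exact hb t ht s hs

end OpAk

/-! ### Comparison of step sizes. -/

namespace TimeMesh

variable {T : ℝ} (P : TimeMesh T)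

theorem sum_step_sub {m n : ℕ} :
    ∑ i ∈ Finset.range n, P.step (m - i) = P.t m - P.t (m - n) := by
  have := Finset.sum_range_sub' (fun i => P.t (m - i)) n
  simpa [step, Nat.sub_sub] using this

theorem abs_step_sub_le {m l : ℕ} (h1 : 1 ≤ m) (hm : m ≤ P.M) (hl1 : 1 ≤ l) (hl : l ≤ P.M) :
    |P.step m - P.step l| ≤ P.kmax - P.kmin := by
  have h : ∀ j, 1 ≤ j → j ≤ P.M → P.kmin ≤ P.step j ∧ P.step j ≤ P.kmax := fun j hj hj' =>
    ⟨Finset.inf'_le _ (Finset.mem_Icc.2 ⟨hj, hj'⟩), Finset.le_sup' _ (Finset.mem_Icc.2 ⟨hj, hj'⟩)⟩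
  have := h m h1 hm
  have := h l hl1 hl
  rw [abs_le]
  constructor <;> linarith

/-- Both steps are lengths of subintervals of `(t_{l-1}, t_m]`. Unlike the bound by `kmax - kmin`,
this one is small when the intervals are close. -/
theorem abs_step_sub_le_length {m l : ℕ} (hl : 1 ≤ l) (hlm : l < m) (hm : m ≤ P.M) :
    |P.step m - P.step l| ≤ P.t m - P.t (l - 1) := by
  have h1 := P.step_pos (hl.trans hlm.le) hm
  have h2 := P.step_pos hl (hlm.le.trans hm)
  have h3 := P.t_le (show l ≤ m - 1 by omega) (by omega)
  rw [step] at h1 h2 ⊢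
  rw [step, abs_le]
  constructor <;> linarith

theorem Admissible.step_le {P : TimeMesh T} {c β κ : ℝ} (hP : P.Admissible c β κ) (hκ : 0 < κ)
    {m : ℕ} (h1 : 1 ≤ m) (hm : m + 1 ≤ P.M) :
    P.step m ≤ κ * P.step (m + 1) ∧ P.step (m + 1) ≤ κ * P.step m := by
  obtain ⟨h2, h3⟩ := hP.ratio m h1 hm
  have h4 := P.step_pos (m := m + 1) (by omega) hm
  rw [le_div_iff₀ h4, inv_mul_le_iff₀ hκ] at h2
  exact ⟨(div_le_iff₀ h4).1 h3, h2⟩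

end TimeMesh

/-! ### Transformed operators and the kernel estimate. -/

/-- Combines the three energy estimates. Here `p` and `q` stand for `1 + k_m μ` and `1 + k_l μ`; `(p
A + D)² ≤ p q (2 A + D)²` lets them cancel, so the bound does not degrade when `k μ` is large. -/
theorem kernel_le_of_energy_le {α μ κ s p q A D G y w g : ℝ} (hα : 0 < α) (hμ : 0 < μ) (hκ : 0 < κ)
    (hs : 0 < s) (hp1 : 1 ≤ p) (hq1 : 1 ≤ q) (hpq : p ≤ 2 * q) (hA0 : 0 ≤ A) (hD0 : 0 ≤ D)
    (hg : 0 ≤ g) (hG : 4 * α * μ * q * G ^ 2 ≤ g ^ 2) (hy : α * p * y ≤ ((p * A + D) * G) ^ 2)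
    (hw : s ^ 3 * w ^ 2 ≤ (κ + 1) * y) :
    2 * α * Real.sqrt μ * s ^ (3 / 2 : ℝ) * w ≤ Real.sqrt (κ + 1) * (2 * A + D) * g := by
  have hN : (p * A + D) ^ 2 ≤ p * q * (2 * A + D) ^ 2 := by
    have e1 : p * A * (p * A) ≤ p * A * (2 * q * A) := by gcongr
    have e2 : p * A * D ≤ p * A * D * q := le_mul_of_one_le_right (by positivity) hq1
    have e3 : D ^ 2 ≤ p * q * D ^ 2 :=
      le_mul_of_one_le_left (by positivity) (one_le_mul_of_one_le_of_one_le hp1 hq1)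
    have e4 : 0 ≤ p * q * A ^ 2 := by positivity
    have e5 : 0 ≤ p * A * D * q := by positivity
    linarith
  have hmain : (2 * α) ^ 2 * μ * s ^ 3 * w ^ 2 ≤ (κ + 1) * (2 * A + D) ^ 2 * g ^ 2 := by
    have hpq0 : 0 < p * q := by positivity
    refine le_of_mul_le_mul_left ?_ hpq0
    calc p * q * ((2 * α) ^ 2 * μ * s ^ 3 * w ^ 2)
        = 4 * α * μ * q * (α * p) * (s ^ 3 * w ^ 2) := by ring
      _ ≤ 4 * α * μ * q * (α * p) * ((κ + 1) * y) := by gcongr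
      _ = 4 * α * μ * q * (κ + 1) * (α * p * y) := by ring
      _ ≤ 4 * α * μ * q * (κ + 1) * ((p * A + D) * G) ^ 2 := by gcongr
      _ = (κ + 1) * (p * A + D) ^ 2 * (4 * α * μ * q * G ^ 2) := by ring
      _ ≤ (κ + 1) * (p * q * (2 * A + D) ^ 2) * g ^ 2 := by gcongr
      _ = _ := by ring
  have hμs : Real.sqrt μ ^ 2 = μ := Real.sq_sqrt hμ.le
  have hκs : Real.sqrt (κ + 1) ^ 2 = κ + 1 := Real.sq_sqrt (by positivity)
  have hss : (s ^ (3 / 2 : ℝ)) ^ 2 = s ^ 3 := by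
    rw [← Real.rpow_natCast, ← Real.rpow_mul hs.le, ← Real.rpow_natCast]; norm_num
  refine le_of_sq_le_sq ?_ (by positivity)
  simp only [mul_pow, hμs, hκs, hss]
  simpa only [mul_pow] using hmain

section Transformed

variable {d : ℕ} {Ω : Set (E d)} {T α μ L : ℝ} {om : ℝ → ℝ} {a : Fin d → Fin d → ℝ → E d → ℝ}
  (P : TimeMesh T) {m l j : ℕ}

theorem opAt_apply (u v : H10 Ω) : opAt Ω a P μ m u v
    = (1 + P.step m * μ) * opAk Ω a P m u v + μ * embed Ω u v := by
  simp [opAt]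

theorem AdmissibleCoeff.opAt_symm (ha : AdmissibleCoeff Ω T α om a) (hT : 0 < T)
    (h1 : 1 ≤ m) (hm : m ≤ P.M) (u v : H10 Ω) : opAt Ω a P μ m u v = opAt Ω a P μ m v u := by
  rw [opAt_apply, opAt_apply, ha.opAk_symm P hT h1 hm, embed_symm]

theorem AdmissibleCoeff.le_opAt_self (ha : AdmissibleCoeff Ω T α om a) (hT : 0 < T) (hμ : 0 < μ)
    (h1 : 1 ≤ m) (hm : m ≤ P.M) (u : H10 Ω) :
    α * (1 + P.step m * μ) * gradNorm u ^ 2 + μ * l2norm u ^ 2 ≤ opAt Ω a P μ m u u := by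
  rw [opAt_apply, embed_self]
  have := P.step_pos h1 hm
  have := mul_le_mul_of_nonneg_left (ha.le_opAk_self P hT h1 hm u)
    (show 0 ≤ 1 + P.step m * μ by positivity)
  linarith

theorem AdmissibleCoeff.opAt_coercive (ha : AdmissibleCoeff Ω T α om a) (hT : 0 < T) (hα : 0 < α)
    (hμ : 0 < μ) (h1 : 1 ≤ m) (hm : m ≤ P.M) (u : H10 Ω) :
    min α μ * ‖u‖ ^ 2 ≤ opAt Ω a P μ m u u := by
  refine le_trans ?_ (ha.le_opAt_self P hT hμ h1 hm u)
  have hk := P.step_pos h1 hm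
  rw [norm_sq_eq, mul_add, add_comm]
  gcongr
  · refine (min_le_left _ _).trans ?_
    have : 0 ≤ α * (P.step m * μ) := by positivity
    linarith
  · exact min_le_right _ _

theorem AdmissibleCoeff.opAt_isInvertible (ha : AdmissibleCoeff Ω T α om a) (hT : 0 < T)
    (hα : 0 < α) (hμ : 0 < μ) (h1 : 1 ≤ m) (hm : m ≤ P.M) : (opAt Ω a P μ m).IsInvertible :=
  isInvertible_of_coercive (lt_min hα hμ) (ha.opAt_coercive P hT hα hμ h1 hm)

theorem AdmissibleCoeff.step_isInvertible (ha : AdmissibleCoeff Ω T α om a) (hT : 0 < T)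
    (hα : 0 < α) (hμ : 0 < μ) (h1 : 1 ≤ m) (hm : m ≤ P.M) (hj1 : 1 ≤ j) (hj : j ≤ P.M) :
    (embed Ω + P.step j • opAt Ω a P μ m).IsInvertible := by
  have hk := P.step_pos hj1 hj
  refine isInvertible_of_coercive (mul_pos hk (lt_min hα hμ)) fun u => ?_
  have h := mul_le_mul_of_nonneg_left (ha.opAt_coercive P hT hα hμ h1 hm u) hk.le
  have h2 : (embed Ω + P.step j • opAt Ω a P μ m) u u
      = l2norm u ^ 2 + P.step j * opAt Ω a P μ m u u := by simp [embed_self]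
  rw [h2, mul_assoc]
  nlinarith [sq_nonneg (l2norm u)]

/-- The `μ Id` terms cancel, leaving the variation of the averaged operator in time and the
variation of the step in the factor `1 + k μ`. -/
theorem opAt_sub_apply (u v : H10 Ω) : (opAt Ω a P μ m - opAt Ω a P μ l) u v
    = (1 + P.step m * μ) * (opAk Ω a P m u v - opAk Ω a P l u v)
      + (P.step m - P.step l) * μ * opAk Ω a P l u v := by
  simp only [sub_apply, opAt_apply]
  ring

/-- The gradient of `Ã⁻¹ g`. -/
theorem AdmissibleCoeff.gradNorm_inverse_le (ha : AdmissibleCoeff Ω T α om a) (hT : 0 < T)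
    (hα : 0 < α) (hμ : 0 < μ) (h1 : 1 ≤ m) (hm : m ≤ P.M) (g : H10 Ω) :
    4 * α * μ * (1 + P.step m * μ) * gradNorm ((opAt Ω a P μ m).inverse (embed Ω g)) ^ 2
      ≤ l2norm g ^ 2 := by
  set φ := (opAt Ω a P μ m).inverse (embed Ω g) with hφ
  have h2 := ha.le_opAt_self P hT hμ h1 hm φ
  rw [hφ, (ha.opAt_isInvertible P hT hα hμ h1 hm).self_apply_inverse, ← hφ,
    embed_apply_eq_inner] at h2
  have h3 : inner ℝ (toL2 Ω g) (toL2 Ω φ) ≤ l2norm g * l2norm φ := real_inner_le_norm _ _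
  have h4 : 4 * μ * (α * (1 + P.step m * μ) * gradNorm φ ^ 2 + μ * l2norm φ ^ 2)
      ≤ 4 * μ * (l2norm g * l2norm φ) := mul_le_mul_of_nonneg_left (h2.trans h3) (by positivity)
  -- Completing the square absorbs the `L²` part: `4 μ x y - 4 μ² y² ≤ x²`. This is where the gain
  -- `μ^(-1/2)` arises.
  nlinarith [sq_nonneg (l2norm g - 2 * μ * l2norm φ)]

/-- The energy of `Ã⁻¹ F` for a functional `F` that is controlled by the gradient. -/
theorem AdmissibleCoeff.apply_inverse_le (ha : AdmissibleCoeff Ω T α om a) (hT : 0 < T)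
    (hα : 0 < α) (hμ : 0 < μ) (h1 : 1 ≤ m) (hm : m ≤ P.M) {F : Hm1 Ω} {N : ℝ}
    (hF : ∀ v, |F v| ≤ N * gradNorm v) :
    α * (1 + P.step m * μ) * F ((opAt Ω a P μ m).inverse F) ≤ N ^ 2 := by
  set χ := (opAt Ω a P μ m).inverse F with hχ
  have hk := P.step_pos h1 hm
  have h2 := ha.le_opAt_self P hT hμ h1 hm χ
  rw [hχ, (ha.opAt_isInvertible P hT hα hμ h1 hm).self_apply_inverse, ← hχ] at h2
  have h3 := (le_abs_self _).trans (hF χ)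
  set p := α * (1 + P.step m * μ) with hp
  have hp0 : 0 < p := by positivity
  have h4 : p * gradNorm χ ^ 2 ≤ F χ := by nlinarith [sq_nonneg (l2norm χ)]
  have h5 : p * F χ ≤ p * (N * gradNorm χ) := mul_le_mul_of_nonneg_left h3 hp0.le
  have h6 : p * (p * gradNorm χ ^ 2) ≤ p * (N * gradNorm χ) :=
    mul_le_mul_of_nonneg_left (h4.trans h3) hp0.le
  nlinarith [sq_nonneg (N - p * gradNorm χ)]

theorem AdmissibleCoeff.abs_opAt_sub_le (ha : AdmissibleCoeff Ω T α om a) (hT : 0 < T)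
    (hL0 : 0 ≤ L) (hL : ∀ i j, ∀ᵐ x ∂(volume.restrict Ω), ∀ t ∈ Icc 0 T, |a i j t x| ≤ L)
    (hμ : 0 < μ) (hl : 1 ≤ l) (hlm : l ≤ m) (hm : m ≤ P.M) (u v : H10 Ω) :
    |(opAt Ω a P μ m - opAt Ω a P μ l) u v|
      ≤ ((1 + P.step m * μ) * (d ^ 2 * om (P.t m - P.t (l - 1)))
        + |P.step m - P.step l| * μ * (d ^ 2 * L)) * gradNorm u * gradNorm v := by
  have hk := P.step_pos (hl.trans hlm) hm
  have h1 := ha.abs_opAk_sub_le P hT hl hlm hm u v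
  have h2 := ha.abs_opAk_le P hT hL0 hL hl (hlm.trans hm) u v
  rw [opAt_sub_apply]
  refine (abs_add_le _ _).trans ?_
  rw [abs_mul, abs_mul, abs_mul, abs_of_pos hμ,
    abs_of_pos (show 0 < 1 + P.step m * μ by positivity)]
  have h3 := mul_le_mul_of_nonneg_left h1 (show 0 ≤ 1 + P.step m * μ by positivity)
  have h4 := mul_le_mul_of_nonneg_left h2 (show 0 ≤ |P.step m - P.step l| * μ by positivity)
  linarith

/-- The bound for the kernel of `Q̃`. -/
theorem AdmissibleCoeff.exists_kernel (ha : AdmissibleCoeff Ω T α om a) (hT : 0 < T)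
    (hα : 0 < α) (hL0 : 0 ≤ L)
    (hL : ∀ i j, ∀ᵐ x ∂(volume.restrict Ω), ∀ t ∈ Icc 0 T, |a i j t x| ≤ L)
    (hμ : 0 < μ) {c β κ ε : ℝ} (hκ : 0 < κ) (hε : 0 ≤ ε) (hεμ : ε ^ 4 * μ ≤ 1)
    (hP : P.Admissible c β κ) (hk : P.kmax - P.kmin ≤ ε ^ 4)
    (hl : 1 ≤ l) (hlm : l < m) (hm : m ≤ P.M) :
    ∃ W : H10 Ω →L[ℝ] H10 Ω, ∀ g,
      embed Ω (W g) = opAt Ω a P μ m (opRt Ω a P μ m l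
        ((opAt Ω a P μ m - opAt Ω a P μ l) ((opAt Ω a P μ l).inverse (embed Ω g)))) ∧
      l2norm (W g) ≤ (Real.sqrt (κ + 1) * d ^ 2 / (α * Real.sqrt μ)
          * (om (P.t m - P.t (l - 1)) / (P.t m - P.t (l - 1)) ^ (3 / 2 : ℝ))
        + Real.sqrt (κ + 1) * d ^ 2 * L * Real.sqrt μ * ε / (2 * α)
          * (P.t m - P.t (l - 1)) ^ (-(3 / 4) : ℝ)) * l2norm g := by
  have h1 : 1 ≤ m := hl.trans hlm.le
  -- As `l < m`, the product has `m - l + 1 = n + 2 ≥ 2` factors, as the smoothing estimate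
  -- requires; their steps add up to `t_m - t_{l-1}`.
  obtain ⟨n, hn⟩ : ∃ n, m = l + (n + 1) := ⟨m - l - 1, by omega⟩
  have hR : opRt Ω a P μ m l = resolventProd Ω a P μ m (n + 1) := by
    rw [opRt, hn, Nat.add_sub_cancel_left]
  have hst : ∀ i ≤ n, P.step (m - i) ≤ κ * P.step (m - (i + 1)) ∧
      P.step (m - (i + 1)) ≤ κ * P.step (m - i) := fun i hi => by
    have := hP.step_le hκ (m := m - (i + 1)) (by omega) (by omega)
    rw [show m - (i + 1) + 1 = m - i by omega] at this
    exact this.symm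
  obtain ⟨W, hW⟩ := exists_smoothing (ha.opAt_isInvertible P hT hα hμ h1 hm)
    (ha.opAt_symm P hT h1 hm)
    (fun u => le_trans (by have := lt_min hα hμ; positivity)
      (ha.opAt_coercive P hT hα hμ h1 hm u)) hκ.le n
    (fun i hi => ha.step_isInvertible P hT hα hμ h1 hm (by omega) (by omega))
    (fun i hi => (P.step_pos (by omega) (by omega)).le) (fun i hi => (hst i hi).1)
    (fun i hi => (hst i hi).2)
  refine ⟨W ∘L (opAt Ω a P μ m - opAt Ω a P μ l) ∘L (opAt Ω a P μ l).inverse ∘L embed Ω,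
    fun g => ⟨by rw [hR]; exact (hW _).1, ?_⟩⟩
  set φ := (opAt Ω a P μ l).inverse (embed Ω g) with hφ
  set F := (opAt Ω a P μ m - opAt Ω a P μ l) φ with hF
  change l2norm (W F) ≤ _
  have hW2 := (hW F).2
  rw [P.sum_step_sub, show m - (n + 2) = l - 1 by omega] at hW2
  have hG := ha.gradNorm_inverse_le P hT hα hμ hl (hlm.le.trans hm) g
  have hFb := ha.apply_inverse_le P hT hα hμ h1 hm
    (ha.abs_opAt_sub_le P hT hL0 hL hμ hl hlm.le hm φ)
  have hkm := P.step_pos h1 hm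
  have hkl := P.step_pos hl (hlm.le.trans hm)
  have hθ := P.abs_step_sub_le_length hl hlm hm
  have hθ' := (P.abs_step_sub_le h1 hm hl (hlm.le.trans hm)).trans hk
  have hs : 0 < P.t m - P.t (l - 1) := by
    have h2 := P.t_le hlm.le hm
    rw [TimeMesh.step] at hkl
    linarith
  have hsT : P.t m - P.t (l - 1) ≤ T := by
    linarith [(P.t_mem hm).2, (P.t_mem (m := l - 1) (by omega)).1]
  have hom := ha.omega_nonneg _ ⟨hs.le, hsT⟩
  rw [← hφ] at hG
  rw [← hF] at hFb
  set s := P.t m - P.t (l - 1) with hsdef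
  set θ := |P.step m - P.step l| with hθdef
  have hθ0 : 0 ≤ θ := abs_nonneg _
  -- Here `|k_m - k_l| μ ≤ ε⁴ μ ≤ 1`.
  have hpq : 1 + P.step m * μ ≤ 2 * (1 + P.step l * μ) := by
    have := (le_abs_self (P.step m - P.step l)).trans hθ'
    have := mul_le_mul_of_nonneg_right this hμ.le
    nlinarith [mul_pos hkl hμ]
  have hp1 : 1 ≤ 1 + P.step m * μ := by nlinarith [mul_pos hkm hμ]
  have hq1 : 1 ≤ 1 + P.step l * μ := by nlinarith [mul_pos hkl hμ]
  set p := 1 + P.step m * μ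
  set q := 1 + P.step l * μ
  -- Interpolation between `θ ≤ ε⁴` with weight `1/4` and `θ ≤ s` with weight `3/4`. The exponent
  -- keeps `s^(3/4) / s^(3/2)` integrable at zero while leaving a small factor `ε`.
  have hθs : θ ≤ ε * s ^ (3 / 4 : ℝ) := by
    calc θ = θ ^ (1 / 4 : ℝ) * θ ^ (3 / 4 : ℝ) := by
          rw [← Real.rpow_add_of_nonneg hθ0 (by norm_num) (by norm_num)]; norm_num
      _ ≤ (ε ^ 4) ^ (1 / 4 : ℝ) * s ^ (3 / 4 : ℝ) := by gcongr
      _ = ε * s ^ (3 / 4 : ℝ) := by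
          rw [← Real.rpow_natCast, ← Real.rpow_mul hε]; norm_num
  set A := (d : ℝ) ^ 2 * om s with hA
  have hA0 : 0 ≤ A := by positivity
  set D := θ * μ * (d ^ 2 * L) with hD
  have hD0 : 0 ≤ D := by positivity
  have hroot : 2 * α * Real.sqrt μ * s ^ (3 / 2 : ℝ) * l2norm (W F)
      ≤ Real.sqrt (κ + 1) * (2 * A + D) * l2norm g :=
    kernel_le_of_energy_le hα hμ hκ hs hp1 hq1 hpq hA0 hD0 (l2norm_nonneg g) hG hFb hW2
  have hsq : 0 < Real.sqrt μ := Real.sqrt_pos.2 hμ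
  have hsr : 0 < s ^ (3 / 2 : ℝ) := Real.rpow_pos_of_pos hs _
  have hDle : D ≤ ε * s ^ (3 / 4 : ℝ) * μ * (d ^ 2 * L) := by rw [hD]; gcongr
  have hg := l2norm_nonneg g
  have h34 : s ^ (-(3 / 4) : ℝ) = s ^ (3 / 4 : ℝ) / s ^ (3 / 2 : ℝ) := by
    rw [← Real.rpow_sub hs]; norm_num
  have hfin : l2norm (W F)
      ≤ (Real.sqrt (κ + 1) * (2 * A + ε * s ^ (3 / 4 : ℝ) * μ * (d ^ 2 * L)) * l2norm g)
        / (2 * α * Real.sqrt μ * s ^ (3 / 2 : ℝ)) := by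
    rw [le_div_iff₀ (by positivity), mul_comm]
    refine hroot.trans ?_
    gcongr
  refine hfin.trans (le_of_eq ?_)
  rw [h34, hA]
  nth_rewrite 1 [← Real.sq_sqrt hμ.le]
  field_simp

end Transformed

/-! ### Riemann sums of a nonincreasing majorant. -/

section Sums

variable {T : ℝ} {f : ℝ → ℝ}

/-- The right endpoint value is the minimum over the interval. Only right endpoints are used, so a
singularity at zero is harmless. -/
theorem sub_mul_le_integral (hanti : AntitoneOn f (Ioc 0 T))
    (hint : IntegrableOn f (Ioc 0 T)) {x y : ℝ} (hx : 0 ≤ x) (hxy : x < y) (hy : y ≤ T) :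
    (y - x) * f y ≤ (∫ s in (0 : ℝ)..y, f s) - ∫ s in (0 : ℝ)..x, f s := by
  have hi : ∀ z, 0 ≤ z → z ≤ T → IntervalIntegrable f volume 0 z := fun z h0 h1 =>
    (intervalIntegrable_iff_integrableOn_Ioc_of_le h0).2 (hint.mono_set (Ioc_subset_Ioc_right h1))
  rw [intervalIntegral.integral_interval_sub_left (hi y (hx.trans hxy.le) hy)
    (hi x hx (hxy.le.trans hy))]
  have hi' : IntervalIntegrable f volume x y :=
    (hi x hx (hxy.le.trans hy)).symm.trans (hi y (hx.trans hxy.le) hy)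
  rw [intervalIntegral.integral_of_le hxy.le]
  have h := setIntegral_mono_on (f := fun _ => f y) (g := f) (μ := volume) (s := Ioc x y)
    (integrableOn_const measure_Ioc_lt_top.ne)
    ((intervalIntegrable_iff_integrableOn_Ioc_of_le hxy.le).1 hi') measurableSet_Ioc
    (fun s hs => hanti ⟨hx.trans_lt hs.1, hs.2.trans hy⟩ ⟨hx.trans_lt hxy, hy⟩ hs.2)
  rwa [setIntegral_const, Real.volume_real_Ioc_of_le hxy.le, smul_eq_mul] at h

theorem integral_nonneg_of_mem (h0 : ∀ x ∈ Ioc 0 T, 0 ≤ f x) {x : ℝ} (hx : x ∈ Icc 0 T) :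
    0 ≤ ∫ s in (0 : ℝ)..x, f s := by
  rw [intervalIntegral.integral_of_le hx.1]
  exact setIntegral_nonneg measurableSet_Ioc fun s hs => h0 s ⟨hs.1, hs.2.trans hx.2⟩

theorem integral_le_of_mem (hint : IntegrableOn f (Ioc 0 T)) (h0 : ∀ x ∈ Ioc 0 T, 0 ≤ f x)
    {x : ℝ} (hx : x ∈ Icc 0 T) : ∫ s in (0 : ℝ)..x, f s ≤ ∫ s in (0 : ℝ)..T, f s := by
  rw [intervalIntegral.integral_of_le hx.1, intervalIntegral.integral_of_le (hx.1.trans hx.2)]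
  refine setIntegral_mono_set hint ?_ (Ioc_subset_Ioc_right hx.2).eventuallyLE
  exact (ae_restrict_iff' measurableSet_Ioc).2 (Filter.Eventually.of_forall h0)

namespace TimeMesh

variable (P : TimeMesh T)

theorem sub_mem {i j : ℕ} (hij : i ≤ j) (hj : j ≤ P.M) : P.t j - P.t i ∈ Icc 0 T := by
  have h1 := P.t_le hij hj
  have h2 := P.t_mem hj
  have h3 := P.t_mem (hij.trans hj)
  exact ⟨by linarith, by linarith [h2.2, h3.1]⟩

theorem sum_left_le (hanti : AntitoneOn f (Ioc 0 T))
    (hint : IntegrableOn f (Ioc 0 T)) (h0 : ∀ x ∈ Ioc 0 T, 0 ≤ f x) {m : ℕ} (h1 : 1 ≤ m)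
    (hm : m ≤ P.M) :
    ∑ l ∈ Finset.Ico 1 m, P.step l * f (P.t m - P.t (l - 1)) ≤ ∫ s in (0 : ℝ)..T, f s := by
  have key : ∀ n, 1 ≤ n → n ≤ m → ∑ l ∈ Finset.Ico 1 n, P.step l * f (P.t m - P.t (l - 1))
      ≤ (∫ s in (0 : ℝ)..(P.t m - P.t 0), f s) - ∫ s in (0 : ℝ)..(P.t m - P.t (n - 1)), f s := by
    intro n hn
    induction n, hn using Nat.le_induction with
    | base => intro _; simp
    | succ n hn ih =>
      intro hnm
      rw [Finset.sum_Ico_succ_top hn]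
      have h2 := ih (by omega)
      have h3 := P.step_pos hn (by omega)
      have h4 := sub_mul_le_integral hanti hint (x := P.t m - P.t n)
        (y := P.t m - P.t (n - 1)) (P.sub_mem (by omega) hm).1
        (by rw [step] at h3; linarith) (P.sub_mem (by omega) hm).2
      have e : P.t m - P.t (n - 1) - (P.t m - P.t n) = P.step n := by rw [step]; ring
      rw [e] at h4
      rw [Nat.add_sub_cancel]
      linarith
  -- The telescoped sum misses the integral over `(0, k_m]`, since `l = m` is not summed; it is
  -- nonnegative and can be dropped.
  have h2 := integral_nonneg_of_mem h0 (P.sub_mem (show m - 1 ≤ m by omega) hm)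
  have h3 := integral_le_of_mem hint h0 (P.sub_mem (Nat.zero_le m) hm)
  linarith [key m h1 le_rfl]

theorem sum_right_le (hanti : AntitoneOn f (Ioc 0 T))
    (hint : IntegrableOn f (Ioc 0 T)) (h0 : ∀ x ∈ Ioc 0 T, 0 ≤ f x) {l : ℕ} (hl : l ≤ P.M) :
    ∑ m ∈ Finset.Ioc l P.M, P.step m * f (P.t m - P.t (l - 1)) ≤ ∫ s in (0 : ℝ)..T, f s := by
  have key : ∀ n, l ≤ n → n ≤ P.M → ∑ m ∈ Finset.Ioc l n, P.step m * f (P.t m - P.t (l - 1))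
      ≤ (∫ s in (0 : ℝ)..(P.t n - P.t (l - 1)), f s)
        - ∫ s in (0 : ℝ)..(P.t l - P.t (l - 1)), f s := by
    intro n hn
    induction n, hn using Nat.le_induction with
    | base => intro _; simp
    | succ n hn ih =>
      intro hnM
      rw [Finset.sum_Ioc_succ_top hn]
      have h2 := ih (by omega)
      have h3 := P.t_lt n (by omega)
      have h4 := sub_mul_le_integral hanti hint (x := P.t n - P.t (l - 1))
        (y := P.t (n + 1) - P.t (l - 1)) (P.sub_mem (by omega) (by omega)).1
        (by linarith) (P.sub_mem (by omega) hnM).2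
      have e : P.t (n + 1) - P.t (l - 1) - (P.t n - P.t (l - 1)) = P.step (n + 1) := by
        rw [step, Nat.add_sub_cancel]; ring
      rw [e] at h4
      linarith
  have h2 := integral_nonneg_of_mem h0 (P.sub_mem (show l - 1 ≤ l by omega) hl)
  have h3 := integral_le_of_mem hint h0 (P.sub_mem (show l - 1 ≤ P.M by omega) le_rfl)
  linarith [key P.M hl le_rfl]

end TimeMesh

end Sums

/-! ### Construction of operators on `X_k^0`. -/

namespace TimeMesh

variable {T : ℝ} (P : TimeMesh T) {d : ℕ} {Ω : Set (E d)}

theorem interval_subset_Ioc {m : ℕ} (hm : m ≤ P.M) : P.interval m ⊆ Ioc 0 T := fun _ ht =>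
  ⟨(P.t_mem ((Nat.sub_le m 1).trans hm)).1.trans_lt ht.1, ht.2.trans (P.t_mem hm).2⟩

theorem eq_of_mem_interval {i j : ℕ} (hi : i ≤ P.M) (hj : j ≤ P.M) {s : ℝ}
    (h1 : s ∈ P.interval i) (h2 : s ∈ P.interval j) : i = j := by
  rcases lt_trichotomy i j with h | h | h
  · have := P.t_le (show i ≤ j - 1 by omega) (by omega)
    linarith [h1.2, h2.1]
  · exact h
  · have := P.t_le (show j ≤ i - 1 by omega) (by omega)
    linarith [h2.2, h1.1]

/-- The value on `I_m` as a linear map. -/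
noncomputable def valₗ (Ω : Set (E d)) (m : ℕ) : P.X0 Ω →ₗ[ℝ] H10 Ω where
  toFun g := P.val g m
  map_add' _ _ := rfl
  map_smul' _ _ := rfl

/-- A linear map into `X_k^0` may be prescribed by its values on the intervals `I_m`. -/
theorem exists_linearMap (q : ℕ → P.X0 Ω →ₗ[ℝ] H10 Ω) :
    ∃ Q : P.X0 Ω →ₗ[ℝ] P.X0 Ω, ∀ g, ∀ m ∈ Finset.Icc 1 P.M, P.val (Q g) m = q m g := by
  let F : P.X0 Ω → ℝ → H10 Ω := fun g s =>
    ∑ m ∈ Finset.Icc 1 P.M, (P.interval m).indicator (fun _ => q m g) s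
  have hF : ∀ g, ∀ m ∈ Finset.Icc 1 P.M, ∀ s ∈ P.interval m, F g s = q m g := by
    intro g m hm s hs
    have h1 : F g s = (P.interval m).indicator (fun _ => q m g) s := by
      refine Finset.sum_eq_single_of_mem m hm fun j hj hjm => ?_
      refine indicator_of_notMem (fun hsj => hjm ?_) _
      exact P.eq_of_mem_interval (Finset.mem_Icc.1 hj).2 (Finset.mem_Icc.1 hm).2 hsj hs
    rw [h1, indicator_of_mem hs]
  have hmem : ∀ g, F g ∈ P.X0 Ω := fun g => by
    refine ⟨fun m hm => ⟨q m g, hF g m hm⟩, fun s hs => Finset.sum_eq_zero fun m hm => ?_⟩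
    exact indicator_of_notMem
      (fun h => hs (P.interval_subset_Ioc (Finset.mem_Icc.1 hm).2 h)) _
  refine ⟨{ toFun := fun g => ⟨F g, hmem g⟩, map_add' := ?_, map_smul' := ?_ }, ?_⟩
  · intro g h
    ext1
    funext s
    change F (g + h) s = F g s + F h s
    simp only [F, ← Finset.sum_add_distrib]
    refine Finset.sum_congr rfl fun m _ => ?_
    by_cases hs : s ∈ P.interval m <;> simp [hs]
  · intro r g
    ext1
    funext s
    change F (r • g) s = r • F g s
    simp only [F, Finset.smul_sum]
    refine Finset.sum_congr rfl fun m _ => ?_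
    by_cases hs : s ∈ P.interval m <;> simp [hs]
  · intro g m hm
    refine hF g m hm (P.t m) ⟨?_, le_rfl⟩
    have := P.step_pos (Finset.mem_Icc.1 hm).1 (Finset.mem_Icc.1 hm).2
    rw [step] at this
    linarith

end TimeMesh

/-! ### Volterra bounds and existence of `Q̃`. -/

theorem l2norm_sum_smul_le {d : ℕ} {Ω : Set (E d)} {ι : Type*} (s : Finset ι) {k : ι → ℝ}
    (hk : ∀ i ∈ s, 0 ≤ k i) (u : ι → H10 Ω) :
    l2norm (∑ i ∈ s, k i • u i) ≤ ∑ i ∈ s, k i * l2norm (u i) := by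
  rw [l2norm, map_sum]
  refine (norm_sum_le _ _).trans (Finset.sum_le_sum fun i hi => ?_)
  rw [map_smul, norm_smul, Real.norm_of_nonneg (hk i hi)]
  rfl

/-- A discrete Volterra kernel with small row and column sums is a contraction in the maximum norm
and in the weighted `ℓ¹` norm. -/
theorem volterra_bounds {M : ℕ} {k : ℕ → ℝ} {K : ℕ → ℕ → ℝ} {r : ℝ} {x y : ℕ → ℝ}
    (hk : ∀ m, 1 ≤ m → m ≤ M → 0 ≤ k m) (hK : ∀ l m, 1 ≤ l → l < m → m ≤ M → 0 ≤ K m l)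
    (hx : ∀ l, 0 ≤ x l)
    (hy : ∀ m, 1 ≤ m → m ≤ M → y m ≤ ∑ l ∈ Finset.Ico 1 m, k l * (K m l * x l))
    (hrow : ∀ m, 1 ≤ m → m ≤ M → ∑ l ∈ Finset.Ico 1 m, k l * K m l ≤ r)
    (hcol : ∀ l, 1 ≤ l → l ≤ M → ∑ m ∈ Finset.Ioc l M, k m * K m l ≤ r) :
    (∀ (m : ℕ) (hm : 1 ≤ m), m ≤ M →
      y m ≤ r * (Finset.Icc 1 m).sup' (Finset.nonempty_Icc.2 hm) x) ∧
    ∑ m ∈ Finset.Icc 1 M, k m * y m ≤ r * ∑ l ∈ Finset.Icc 1 M, k l * x l := by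
  constructor
  · intro m h1 hm
    set X := (Finset.Icc 1 m).sup' (Finset.nonempty_Icc.2 h1) x
    have hX : ∀ l ∈ Finset.Icc 1 m, x l ≤ X := fun l hl => Finset.le_sup' x hl
    have hX0 : 0 ≤ X := (hx 1).trans (hX 1 (Finset.mem_Icc.2 ⟨le_rfl, h1⟩))
    calc y m ≤ ∑ l ∈ Finset.Ico 1 m, k l * (K m l * x l) := hy m h1 hm
      _ ≤ ∑ l ∈ Finset.Ico 1 m, k l * K m l * X := by
        refine Finset.sum_le_sum fun l hl => ?_
        obtain ⟨hl1, hlm⟩ := Finset.mem_Ico.1 hl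
        rw [← mul_assoc]
        exact mul_le_mul_of_nonneg_left (hX l (Finset.mem_Icc.2 ⟨hl1, hlm.le⟩))
          (mul_nonneg (hk l hl1 (by omega)) (hK l m hl1 hlm hm))
      _ = (∑ l ∈ Finset.Ico 1 m, k l * K m l) * X := by rw [Finset.sum_mul]
      _ ≤ r * X := mul_le_mul_of_nonneg_right (hrow m h1 hm) hX0
  · calc ∑ m ∈ Finset.Icc 1 M, k m * y m
        ≤ ∑ m ∈ Finset.Icc 1 M, ∑ l ∈ Finset.Ico 1 m, k m * (k l * (K m l * x l)) := by
          refine Finset.sum_le_sum fun m hm => ?_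
          obtain ⟨h1, hm⟩ := Finset.mem_Icc.1 hm
          rw [← Finset.mul_sum]
          exact mul_le_mul_of_nonneg_left (hy m h1 hm) (hk m h1 hm)
      _ = ∑ l ∈ Finset.Icc 1 M, ∑ m ∈ Finset.Ioc l M, k m * (k l * (K m l * x l)) := by
          refine Finset.sum_comm' fun m l => ?_
          simp only [Finset.mem_Icc, Finset.mem_Ico, Finset.mem_Ioc]
          omega
      _ = ∑ l ∈ Finset.Icc 1 M, (∑ m ∈ Finset.Ioc l M, k m * K m l) * (k l * x l) := by
          refine Finset.sum_congr rfl fun l _ => ?_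
          rw [Finset.sum_mul]
          exact Finset.sum_congr rfl fun m _ => by ring
      _ ≤ ∑ l ∈ Finset.Icc 1 M, r * (k l * x l) := by
          refine Finset.sum_le_sum fun l hl => ?_
          obtain ⟨h1, hl⟩ := Finset.mem_Icc.1 hl
          exact mul_le_mul_of_nonneg_right (hcol l h1 hl) (mul_nonneg (hk l h1 hl) (hx l))
      _ = _ := by rw [Finset.mul_sum]

/-- The operator `Q̃` exists and is bounded by the integral of a majorant of its kernel. -/
theorem AdmissibleCoeff.exists_isQt {d : ℕ} {Ω : Set (E d)} {T α μ L c β κ ε : ℝ} {om : ℝ → ℝ}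
    {a : Fin d → Fin d → ℝ → E d → ℝ} (ha : AdmissibleCoeff Ω T α om a) (hT : 0 < T)
    (hα : 0 < α) (hL0 : 0 ≤ L)
    (hL : ∀ i j, ∀ᵐ x ∂(volume.restrict Ω), ∀ t ∈ Icc 0 T, |a i j t x| ≤ L)
    (hμ : 0 < μ) (hκ : 0 < κ) (hε : 0 ≤ ε) (hεμ : ε ^ 4 * μ ≤ 1) (P : TimeMesh T)
    (hP : P.Admissible c β κ) (hk : P.kmax - P.kmin ≤ ε ^ 4) {r : ℝ}
    (hr : Real.sqrt (κ + 1) * d ^ 2 / (α * Real.sqrt μ)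
        * (∫ s in (0 : ℝ)..T, om s / s ^ (3 / 2 : ℝ))
      + Real.sqrt (κ + 1) * d ^ 2 * L * Real.sqrt μ * ε / (2 * α)
        * (∫ s in (0 : ℝ)..T, s ^ (-(3 / 4) : ℝ)) ≤ r) :
    ∃ Q : P.X0 Ω →ₗ[ℝ] P.X0 Ω, IsQt Ω a P μ Q ∧
      ∀ g : P.X0 Ω,
        (∀ (m : ℕ) (hm : 1 ≤ m), m ≤ P.M →
          l2norm (P.val (Q g) m) ≤ r *
            (Finset.Icc 1 m).sup' (Finset.nonempty_Icc.2 hm) (fun l => l2norm (P.val g l))) ∧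
        ∑ m ∈ Finset.Icc 1 P.M, P.step m * l2norm (P.val (Q g) m) ≤
          r * ∑ l ∈ Finset.Icc 1 P.M, P.step l * l2norm (P.val g l) := by
  set c₁ := Real.sqrt (κ + 1) * d ^ 2 / (α * Real.sqrt μ) with hc₁
  set c₂ := Real.sqrt (κ + 1) * d ^ 2 * L * Real.sqrt μ * ε / (2 * α) with hc₂
  have hc₁0 : 0 ≤ c₁ := by positivity
  have hc₂0 : 0 ≤ c₂ := by positivity
  set f : ℝ → ℝ := fun s => c₁ * (om s / s ^ (3 / 2 : ℝ)) + c₂ * s ^ (-(3 / 4) : ℝ) with hf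
  have hW : ∀ m l, ∃ W : H10 Ω →L[ℝ] H10 Ω, 1 ≤ l → l < m → m ≤ P.M → ∀ g,
      embed Ω (W g) = opAt Ω a P μ m (opRt Ω a P μ m l
        ((opAt Ω a P μ m - opAt Ω a P μ l) ((opAt Ω a P μ l).inverse (embed Ω g)))) ∧
      l2norm (W g) ≤ f (P.t m - P.t (l - 1)) * l2norm g := by
    intro m l
    by_cases h : 1 ≤ l ∧ l < m ∧ m ≤ P.M
    · obtain ⟨W, hW⟩ := ha.exists_kernel P hT hα hL0 hL hμ hκ hε hεμ hP hk h.1 h.2.1 h.2.2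
      exact ⟨W, fun _ _ _ => hW⟩
    -- Zero is a dummy value outside the range `1 ≤ l < m ≤ M`; it makes the family total so that it
    -- can be chosen at once.
    · exact ⟨0, fun h1 h2 h3 => absurd ⟨h1, h2, h3⟩ h⟩
  choose W hW using hW
  have hi2 : IntegrableOn (fun s : ℝ => s ^ (-(3 / 4) : ℝ)) (Ioc 0 T) :=
    (intervalIntegrable_iff_integrableOn_Ioc_of_le hT.le).1
      (intervalIntegral.intervalIntegrable_rpow' (by norm_num))
  have hint : IntegrableOn f (Ioc 0 T) := (ha.omega_int.const_mul c₁).add (hi2.const_mul c₂)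
  have hI : ∫ s in (0 : ℝ)..T, f s ≤ r := by
    refine le_trans (le_of_eq ?_) hr
    simp only [intervalIntegral.integral_of_le hT.le, hf]
    rw [integral_add (ha.omega_int.const_mul c₁) (hi2.const_mul c₂), integral_const_mul,
      integral_const_mul]
  have hanti : AntitoneOn f (Ioc 0 T) := by
    intro x hx y hy hxy
    have h1 := ha.omega_anti hx hy hxy
    have h2 := Real.rpow_le_rpow_of_nonpos hx.1 hxy (show (-(3 / 4) : ℝ) ≤ 0 by norm_num)
    exact add_le_add (mul_le_mul_of_nonneg_left h1 hc₁0) (mul_le_mul_of_nonneg_left h2 hc₂0)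
  have hf0 : ∀ x ∈ Ioc 0 T, 0 ≤ f x := fun x hx => by
    have := ha.omega_nonneg x (Ioc_subset_Icc_self hx)
    have := hx.1
    positivity
  obtain ⟨Q, hQ⟩ := P.exists_linearMap (Ω := Ω)
    fun m => ∑ l ∈ Finset.Ico 1 m, P.step l • (W m l : H10 Ω →ₗ[ℝ] H10 Ω) ∘ₗ P.valₗ Ω l
  have hQ' : ∀ g, ∀ m ∈ Finset.Icc 1 P.M,
      P.val (Q g) m = ∑ l ∈ Finset.Ico 1 m, P.step l • W m l (P.val g l) := fun g m hm => by
    rw [hQ g m hm, LinearMap.sum_apply]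
    rfl
  refine ⟨Q, ⟨fun t ht u v => ha.opA_apply hT ht u v, fun m hm u v => ?_, fun m hm u v => ?_,
    fun m hm => ?_, fun m hm j hj => ?_, fun g m hm => ?_⟩, fun g => ?_⟩
  · have hm := (Finset.mem_Icc.1 hm).2
    exact (ha.integrableOn_aForm P hT hm u v).congr_fun
      (fun t ht => (ha.opA_apply hT (P.interval_subset hm ht) u v).symm)
      (P.measurableSet_interval m)
  · exact ha.opAk_apply P hT (Finset.mem_Icc.1 hm).1 (Finset.mem_Icc.1 hm).2 u v
  · exact ha.opAt_isInvertible P hT hα hμ (Finset.mem_Icc.1 hm).1 (Finset.mem_Icc.1 hm).2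
  · exact ha.step_isInvertible P hT hα hμ (Finset.mem_Icc.1 hm).1 (Finset.mem_Icc.1 hm).2
      (Finset.mem_Icc.1 hj).1 (Finset.mem_Icc.1 hj).2
  · rw [hQ' g m hm, map_sum, QtExpr]
    refine Finset.sum_congr rfl fun l hl => ?_
    obtain ⟨h1, h2⟩ := Finset.mem_Ico.1 hl
    rw [map_smul, (hW m l h1 h2 (Finset.mem_Icc.1 hm).2 _).1]
  · refine volterra_bounds (K := fun m l => f (P.t m - P.t (l - 1)))
      (fun m h1 hm => (P.step_pos h1 hm).le) (fun l m h1 hlm hm => ?_) (fun l => l2norm_nonneg _)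
      (fun m h1 hm => ?_) (fun m h1 hm => (P.sum_left_le hanti hint hf0 h1 hm).trans hI)
      (fun l _ hl => (P.sum_right_le hanti hint hf0 hl).trans hI)
    · have h2 := P.sub_mem (show l - 1 ≤ m by omega) hm
      have h3 := P.step_pos h1 (hlm.le.trans hm)
      have h4 := P.t_le hlm.le hm
      rw [TimeMesh.step] at h3
      exact hf0 _ ⟨by linarith, h2.2⟩
    · rw [hQ' g m (Finset.mem_Icc.2 ⟨h1, hm⟩)]
      have hk0 : ∀ l ∈ Finset.Ico 1 m, 0 ≤ P.step l := fun l hl =>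
        (P.step_pos (Finset.mem_Ico.1 hl).1 ((Finset.mem_Ico.1 hl).2.le.trans hm)).le
      refine (l2norm_sum_smul_le _ hk0 _).trans (Finset.sum_le_sum fun l hl => ?_)
      exact mul_le_mul_of_nonneg_left
        (hW m l (Finset.mem_Ico.1 hl).1 (Finset.mem_Ico.1 hl).2 hm _).2 (hk0 l hl)

end ParabolicDG

/-! ### Choice of `μ₀` and `δ₀`. -/

theorem proposition3p1 {d : ℕ} (hd : 1 ≤ d) (Ω : Set (ParabolicDG.E d)) (hΩ : IsOpen Ω)
    (T α : ℝ) (hT : 0 < T) (hα : 0 < α) (om : ℝ → ℝ)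
    (a : Fin d → Fin d → ℝ → ParabolicDG.E d → ℝ)
    (ha : ParabolicDG.AdmissibleCoeff Ω T α om a)
    (c β κ : ℝ) (hc : 0 < c) (hβ : 0 < β) (hκ : 0 < κ) :
    ∃ μ₀ : ℝ, 0 < μ₀ ∧ ∀ μ : ℝ, μ₀ ≤ μ → ∃ δ₀ : ℝ, 0 < δ₀ ∧
      ∀ P : ParabolicDG.TimeMesh T, P.Admissible c β κ → P.kmax - P.kmin ≤ δ₀ →
        ∃ Q : P.X0 Ω →ₗ[ℝ] P.X0 Ω, ParabolicDG.IsQt Ω a P μ Q ∧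
          ∀ g : P.X0 Ω,
            (∀ (m : ℕ) (hm : 1 ≤ m), m ≤ P.M →
              ParabolicDG.l2norm (P.val (Q g) m) ≤ 3 / 4 *
                (Finset.Icc 1 m).sup' (Finset.nonempty_Icc.2 hm)
                  (fun l => ParabolicDG.l2norm (P.val g l))) ∧
            ∑ m ∈ Finset.Icc 1 P.M, P.step m * ParabolicDG.l2norm (P.val (Q g) m) ≤
              3 / 4 * ∑ l ∈ Finset.Icc 1 P.M, P.step l * ParabolicDG.l2norm (P.val g l) := by
  obtain ⟨L, hL0, hL⟩ := ha.exists_bound hT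
  set I := ∫ s in (0 : ℝ)..T, om s / s ^ (3 / 2 : ℝ) with hI
  set J := ∫ s in (0 : ℝ)..T, s ^ (-(3 / 4) : ℝ) with hJ
  have hI0 : 0 ≤ I := by
    refine ParabolicDG.integral_nonneg_of_mem (fun x hx => ?_) (right_mem_Icc.2 hT.le)
    exact div_nonneg (ha.omega_nonneg x (Ioc_subset_Icc_self hx)) (Real.rpow_nonneg hx.1.le _)
  have hJ0 : 0 ≤ J := ParabolicDG.integral_nonneg_of_mem
    (fun x hx => Real.rpow_nonneg hx.1.le _) (right_mem_Icc.2 hT.le)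
  set X := Real.sqrt (κ + 1) * d ^ 2 / α * I with hX
  have hX0 : 0 ≤ X := by positivity
  -- This forces `√μ ≥ 3 X`, so the `ω` part contributes `X / √μ ≤ 1/3 ≤ 3/8`.
  refine ⟨1 + (3 * X) ^ 2, by positivity, fun μ hμ => ?_⟩
  have hμ0 : 0 < μ := lt_of_lt_of_le (by positivity) hμ
  set Y := Real.sqrt (κ + 1) * d ^ 2 * L * Real.sqrt μ / (2 * α) * J with hY
  have hY0 : 0 ≤ Y := by positivity
  -- The bounds `1` and `μ⁻¹` give `ε⁴ μ ≤ 1`; the last one gives `ε Y ≤ 3/8`, the other half of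
  -- `3/4`. As `Y` grows with `μ`, `δ₀ = ε⁴` depends on `μ`.
  set ε := min (min 1 μ⁻¹) (3 / 8 / (Y + 1)) with hε
  have hε0 : 0 < ε := lt_min (lt_min one_pos (inv_pos.2 hμ0)) (by positivity)
  have hε1 : ε ≤ 1 := (min_le_left _ _).trans (min_le_left _ _)
  have hε2 : ε ≤ μ⁻¹ := (min_le_left _ _).trans (min_le_right _ _)
  have hε3 : ε ≤ 3 / 8 / (Y + 1) := min_le_right _ _
  have hεμ : ε ^ 4 * μ ≤ 1 := by
    have h1 : ε ^ 4 ≤ μ⁻¹ := (pow_le_of_le_one hε0.le hε1 (by norm_num)).trans hε2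
    exact (mul_le_mul_of_nonneg_right h1 hμ0.le).trans (inv_mul_cancel₀ hμ0.ne').le
  refine ⟨ε ^ 4, by positivity, fun P hP hk => ?_⟩
  refine ha.exists_isQt hT hα hL0 hL hμ0 hκ hε0.le hεμ P hP hk ?_
  rw [← hI, ← hJ]
  have h1 : Real.sqrt (κ + 1) * d ^ 2 / (α * Real.sqrt μ) * I ≤ 3 / 8 := by
    have h2 : 3 * X ≤ Real.sqrt μ := Real.le_sqrt_of_sq_le (by linarith)
    have h3 : 0 < Real.sqrt μ := Real.sqrt_pos.2 hμ0
    have h4 : Real.sqrt (κ + 1) * d ^ 2 / (α * Real.sqrt μ) * I = X / Real.sqrt μ := by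
      rw [hX]; field_simp
    rw [h4, div_le_iff₀ h3]
    linarith
  have h2 : Real.sqrt (κ + 1) * d ^ 2 * L * Real.sqrt μ * ε / (2 * α) * J ≤ 3 / 8 := by
    have h4 : Real.sqrt (κ + 1) * d ^ 2 * L * Real.sqrt μ * ε / (2 * α) * J = ε * Y := by
      rw [hY]; ring
    rw [h4]
    rw [le_div_iff₀ (by positivity)] at hε3
    linarith
  linarith
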